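/- Let $\nu\in\mathbb C$ with $\operatorname{Re}\nu>-1$ and let $f,g:(0,\infty)\to\mathbb C$. Let $J_\nu$ and $K_\nu$ be the Bessel function of the first kind and the modified Bessel function of the second kind (Macdonald function), and put $$\mathscr H_\nu\{f;y\}=\int_0^\infty\sqrt{xy}\,J_\nu(xy)f(x)\,dx,\quad \mathscr K_\nu\{f;y\}=\int_0^\infty\sqrt{xy}\,K_\nu(xy)f(x)\,dx,\quad \mathscr P\{f(x);y\}=\int_0^\infty\frac{x f(x)}{x^2+y^2}\,dx .$$ Consider the identities $$\int_0^\infty y^{\nu+1/2}\,\mathscr H_\nu\{f;y\}\,\mathscr P\{u^{-\nu-1/2}g(u);y\}\,dy=\int_0^\infty f(x)\,\mathscr K_\nu\{g;x\}\,dx,\tag{1}$$ $$\int_0^\infty y^{\nu+1/2}\,\mathscr H_\nu\{f;y\}\,\mathscr P\{u^{-\nu-1/2}g(u);y\}\,dy=\int_0^\infty g(u)\,\mathscr K_\nu\{f;u\}\,du,\tag{2}$$ $$\int_0^\infty f(x)\,\mathscr K_\nu\{g;x\}\,dx=\int_0^\infty g(u)\,\mathscr K_\nu\{f;u\}\,du.\tag{3}$$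 They hold provided that the integrals involved converge absolutely, in the following sense. For (3): the double integral $\int_0^\infty\!\int_0^\infty f(x)\sqrt{xu}\,K_\nu(xu)\,g(u)\,du\,dx$ converges absolutely. For (1) and (2): in addition, for every $y>0$ the integrals defining $\mathscr H_\nu\{f;y\}$ and $\mathscr P\{u^{-\nu-1/2}g(u);y\}$ converge absolutely, and the left-hand side converges absolutely as a double integral once at least one of its two inner transforms is written out as an integral, i.e. at least one of $$\int_0^\infty\!\!\int_0^\infty\Big|y^{\nu+1/2}\,\mathscr H_\nu\{f;y\}\,\frac{u\cdot u^{-\nu-1/2}g(u)}{u^2+y^2}\Big|\,du\,dy,\qquad \int_0^\infty\!\!\int_0^\infty\Big|y^{\nu+1/2}\,\sqrt{xy}\,J_\nu(xy)f(x)\,\mathscr P\{u^{-\nu-1/2}g(u);y\}\Big|\,dx\,dy$$ is finite. -/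

import Mathlib

open MeasureTheory Set

noncomputable section

/-- The Bessel function of the first kind `J_ν(x)` of complex order `ν`, for real `x > 0`, by its
power series `(x/2)^ν * ∑ (-1)^k (x/2)^(2k) / (k! Γ(ν+k+1))`. At a pole of `Γ` Mathlib's `Γ` is `0`,
so the corresponding term is `0`, as it should be (`1/Γ` is entire). -/
def besselJ (ν : ℂ) (x : ℝ) : ℂ :=
  ((x / 2 : ℝ) : ℂ) ^ ν *
    ∑' k : ℕ, (-1 : ℂ) ^ k * ((x / 2 : ℝ) : ℂ) ^ (2 * k) /
      ((Nat.factorial k : ℂ) * Complex.Gamma (ν + k + 1))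

/-- The modified Bessel function of the second kind (Macdonald function) `K_ν(x)` of complex
order `ν`, for real `x > 0`, by `K_ν(x) = ∫_0^∞ exp(-x cosh t) cosh(ν t) dt`. -/
def besselK (ν : ℂ) (x : ℝ) : ℂ :=
  ∫ t in Ioi (0 : ℝ), (Real.exp (-x * Real.cosh t) : ℂ) * Complex.cosh (ν * t)

/-- The kernel `√(xy) J_ν(xy)` of the Hankel transform. -/
def hankelKernel (ν : ℂ) (x y : ℝ) : ℂ := (Real.sqrt (x * y) : ℂ) * besselJ ν (x * y)

/-- The kernel `√(xy) K_ν(xy)` of the `K`-transform. -/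
def kKernel (ν : ℂ) (x y : ℝ) : ℂ := (Real.sqrt (x * y) : ℂ) * besselK ν (x * y)

/-- The kernel `x / (x² + y²)` of the Widder transform. -/
def widderKernel (x y : ℝ) : ℂ := ((x / (x ^ 2 + y ^ 2) : ℝ) : ℂ)

/-- The Hankel transform `H_ν{f; y}`. -/
def hankelTransform (ν : ℂ) (f : ℝ → ℂ) (y : ℝ) : ℂ :=
  ∫ x in Ioi (0 : ℝ), hankelKernel ν x y * f x

/-- The `K`-transform `K_ν{f; y}`. -/
def kTransform (ν : ℂ) (f : ℝ → ℂ) (y : ℝ) : ℂ :=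
  ∫ x in Ioi (0 : ℝ), kKernel ν x y * f x

/-- The Widder (potential) transform `P{f; y}`. -/
def widderTransform (f : ℝ → ℂ) (y : ℝ) : ℂ :=
  ∫ x in Ioi (0 : ℝ), widderKernel x y * f x

/-- The function `u ↦ u^(-ν-1/2) g(u)`. -/
def widderWeight (ν : ℂ) (g : ℝ → ℂ) (u : ℝ) : ℂ := (u : ℂ) ^ (-ν - 1 / 2) * g u

end

/-!
The kernel of the identity is the integral
`∫_0^∞ y^(ν+1) J_ν(xy) / (u² + y²) dy = u^ν K_ν(xu)`: inserting it in the left side and integrating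
in another order gives the right sides. But this integral converges only conditionally or not at
all when `Re ν ≥ 1/2`, and the hypotheses do not make the triple integral absolutely convergent.
So a convergence factor is inserted, `exp(-εy²)` or `exp(-εy²) - exp(-Ty²)`. The regularized kernel
is computed from Weber's integral (`integral_rootBessel_mul_exp_div`); it is a multiple of
`regMacdonald ν x u ε = ∫_0^∞ exp(-u²s) (s+ε)^(-ν-1) exp(-x²/(4(s+ε))) ds`,
whose limit as `ε → 0` is the Macdonald function (`regMacdonald_zero_eq`).

Two facts make the interchange and the passage to the limit possible.

* If `∫ |√(xy) J_ν(xy) f(x)| dx` is finite for every `y > 0`, then `min(1,x)^(Re ν+1/2) f(x)` is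
  integrable (`integrableOn_weight_of_hankel`). By Baire's theorem the integrals are bounded for `y`
  in some interval `[a, b]`, so `∫∫_a^b |√(xy) J_ν(xy)| dy |f(x)| dx` is finite, and the mean of the
  Bessel kernel over `[a, b]` is bounded below in spite of its zeros
  (`exists_le_integral_rootBessel`). That bound and the matching upper bound come from an energy
  estimate for Bessel's equation, without asymptotic expansions.
* The regularized kernels have a majorant that is independent of `ε` and made of the given
  integrable functions (`exists_norm_regMacdonald_le`). For small `xu` it is a multiple
  of `|K_ν(xu)|` itself, except for imaginary `ν ≠ 0`, where `K_ν` has zeros accumulating at `0`,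
  but the regularized integrals are bounded, as partial integration shows.

If the left side converges absolutely in `(y, u)`, the kernel identity is needed integrated against
`f`, for almost every `u` with `g u ≠ 0` (`integral_hankelTransform_div`); if it converges
absolutely in `(y, x)`, integrated against `g`, for almost every `x` with `f x ≠ 0`
(`integral_rootBessel_mul_widderTransform`). The last identity is Fubini's theorem and the symmetry
of `kKernel`.
-/

open Filter Topology

/-! ### The Bessel–Clifford function -/

/-- The entire Bessel–Clifford function `∑ (-z)^k / (k! Γ(ν+k+1))`, so that
`J_ν(x) = (x/2)^ν C_ν(x²/4)`. -/
noncomputable def besselClifford (ν z : ℂ) : ℂ :=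
  ∑' k : ℕ, (-1 : ℂ) ^ k * z ^ k / ((Nat.factorial k : ℂ) * Complex.Gamma (ν + k + 1))

theorem add_nat_add_one_ne_zero {ν : ℂ} (hν : -1 < ν.re) (k : ℕ) : ν + k + 1 ≠ 0 := by
  intro h
  have := congrArg Complex.re h
  simp at this
  have hk : (0 : ℝ) ≤ k := Nat.cast_nonneg k
  linarith

theorem Gamma_add_nat_add_one_ne_zero {ν : ℂ} (hν : -1 < ν.re) (k : ℕ) :
    Complex.Gamma (ν + k + 1) ≠ 0 := by
  apply Complex.Gamma_ne_zero_of_re_pos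
  have hk : (0 : ℝ) ≤ k := Nat.cast_nonneg k
  simp
  linarith

theorem Gamma_add_nat_succ {ν : ℂ} (hν : -1 < ν.re) (k : ℕ) :
    Complex.Gamma (ν + (k + 1 : ℕ) + 1) = (ν + k + 1) * Complex.Gamma (ν + k + 1) := by
  rw [← Complex.Gamma_add_one _ (add_nat_add_one_ne_zero hν k)]
  push_cast
  ring_nf

theorem le_norm_add_nat_add_one (ν : ℂ) (k : ℕ) : ν.re + k + 1 ≤ ‖ν + k + 1‖ := by
  have := Complex.re_le_norm (ν + k + 1)
  simpa using this

theorem norm_Gamma_add_nat_ge_pow {ν : ℂ} (hν : -1 < ν.re) (k : ℕ) :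
    ‖Complex.Gamma (ν + 1)‖ * (ν.re + 1) ^ k ≤ ‖Complex.Gamma (ν + k + 1)‖ := by
  induction k with
  | zero => simp
  | succ k ih =>
    rw [Gamma_add_nat_succ hν, norm_mul, pow_succ, ← mul_assoc, mul_comm]
    have hk : (0 : ℝ) ≤ k := Nat.cast_nonneg k
    exact mul_le_mul (le_trans (by linarith) (le_norm_add_nat_add_one ν k)) ih
      (by have : 0 ≤ ν.re + 1 := by linarith
          positivity) (norm_nonneg _)

/-- The ratio of `Γ(Re ν + k + 1)` and `|Γ(ν + k + 1)|` is bounded in `k`. -/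
theorem Gamma_re_add_nat_le {ν : ℂ} (hν : -1 < ν.re) (k : ℕ) :
    ‖Complex.Gamma (ν + 1)‖ * Real.Gamma (ν.re + k + 1) ≤
      Real.Gamma (ν.re + 1) * ‖Complex.Gamma (ν + k + 1)‖ := by
  induction k with
  | zero => simp [mul_comm]
  | succ k ih =>
    have hk : (0 : ℝ) ≤ k := Nat.cast_nonneg k
    have hpos : 0 < ν.re + k + 1 := by linarith
    have h1 : Real.Gamma (ν.re + (k + 1 : ℕ) + 1) =
        (ν.re + k + 1) * Real.Gamma (ν.re + k + 1) := by
      rw [← Real.Gamma_add_one hpos.ne']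
      push_cast
      ring_nf
    rw [Gamma_add_nat_succ hν, norm_mul, h1]
    calc _ = (ν.re + k + 1) * (‖Complex.Gamma (ν + 1)‖ * Real.Gamma (ν.re + k + 1)) := by ring
      _ ≤ ‖ν + k + 1‖ * (Real.Gamma (ν.re + 1) * ‖Complex.Gamma (ν + k + 1)‖) := by
        refine mul_le_mul (le_norm_add_nat_add_one ν k) ih ?_ (norm_nonneg _)
        have := Real.Gamma_pos_of_pos hpos
        positivity
      _ = _ := by ring

theorem norm_besselClifford_term_le {ν : ℂ} (hν : -1 < ν.re) {z : ℂ} {R : ℝ} (hz : ‖z‖ ≤ R)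
    (k : ℕ) :
    ‖(-1 : ℂ) ^ k * z ^ k / ((Nat.factorial k : ℂ) * Complex.Gamma (ν + k + 1))‖ ≤
      ‖Complex.Gamma (ν + 1)‖⁻¹ * ((R / (ν.re + 1)) ^ k / (Nat.factorial k : ℝ)) := by
  have hG : 0 < ‖Complex.Gamma (ν + 1)‖ := by
    simpa using Gamma_add_nat_add_one_ne_zero hν 0
  have hp : 0 < ν.re + 1 := by linarith
  have hf : (0 : ℝ) < Nat.factorial k := by positivity
  rw [norm_div, norm_mul, norm_mul, norm_pow, norm_pow, norm_neg, norm_one, one_pow, one_mul,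
    Complex.norm_natCast, div_pow]
  calc ‖z‖ ^ k / ((Nat.factorial k : ℝ) * ‖Complex.Gamma (ν + k + 1)‖)
      ≤ R ^ k / ((Nat.factorial k : ℝ) * (‖Complex.Gamma (ν + 1)‖ * (ν.re + 1) ^ k)) := by
        have hR : 0 ≤ R := (norm_nonneg z).trans hz
        gcongr
        exact norm_Gamma_add_nat_ge_pow hν k
    _ = _ := by field_simp

theorem summable_besselClifford_bound (a b : ℝ) :
    Summable fun k : ℕ => a * (b ^ k / (Nat.factorial k : ℝ)) :=
  (Real.summable_pow_div_factorial b).mul_left a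

theorem summable_besselClifford {ν : ℂ} (hν : -1 < ν.re) (z : ℂ) :
    Summable fun k : ℕ =>
      (-1 : ℂ) ^ k * z ^ k / ((Nat.factorial k : ℂ) * Complex.Gamma (ν + k + 1)) :=
  Summable.of_norm_bounded (summable_besselClifford_bound _ _)
    (norm_besselClifford_term_le hν le_rfl)

theorem besselClifford_zero (ν : ℂ) : besselClifford ν 0 = (Complex.Gamma (ν + 1))⁻¹ := by
  rw [besselClifford, tsum_eq_single 0]
  · simp
  · intro k hk
    simp [hk]

theorem hasDerivAt_besselClifford {ν : ℂ} (hν : -1 < ν.re) (z : ℂ) :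
    HasDerivAt (besselClifford ν) (-besselClifford (ν + 1) z) z := by
  set F : ℕ → ℂ → ℂ := fun k z =>
    (-1 : ℂ) ^ k * z ^ k / ((Nat.factorial k : ℂ) * Complex.Gamma (ν + k + 1)) with hF
  have hderiv : ∀ (k : ℕ) (w : ℂ), HasDerivAt (F k)
      ((-1 : ℂ) ^ k * (k * w ^ (k - 1)) / ((Nat.factorial k : ℂ) * Complex.Gamma (ν + k + 1))) w :=
    fun k w => ((hasDerivAt_pow k w).const_mul _).div_const _
  have hU : IsOpen (Metric.ball (0 : ℂ) (‖z‖ + 1)) := Metric.isOpen_ball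
  have hzU : z ∈ Metric.ball (0 : ℂ) (‖z‖ + 1) := by simp
  have hle : ∀ (k : ℕ) (w : ℂ), w ∈ Metric.ball (0 : ℂ) (‖z‖ + 1) → ‖F k w‖ ≤
      ‖Complex.Gamma (ν + 1)‖⁻¹ * (((‖z‖ + 1) / (ν.re + 1)) ^ k / (Nat.factorial k : ℝ)) := by
    intro k w hw
    apply norm_besselClifford_term_le hν
    simpa using (mem_ball_zero_iff.1 hw).le
  have hdiff : ∀ k : ℕ, DifferentiableOn ℂ (F k) (Metric.ball (0 : ℂ) (‖z‖ + 1)) :=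
    fun k w _ => (hderiv k w).differentiableAt.differentiableWithinAt
  have h1 := Complex.differentiableOn_tsum_of_summable_norm
    (summable_besselClifford_bound _ _) hdiff hU hle
  have h2 := Complex.hasSum_deriv_of_summable_norm
    (summable_besselClifford_bound _ _) hdiff hU hle hzU
  have h3 := (h1.differentiableAt (hU.mem_nhds hzU)).hasDerivAt
  suffices key : -besselClifford (ν + 1) z = deriv (fun w => ∑' i : ℕ, F i w) z by
    rw [key]
    exact h3
  rw [← h2.tsum_eq, h2.summable.tsum_eq_zero_add, besselClifford, ← tsum_neg, (hderiv 0 z).deriv]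
  simp only [CharP.cast_eq_zero, zero_mul, mul_zero, zero_div, zero_add]
  refine tsum_congr fun k => ?_
  rw [(hderiv (k + 1) z).deriv, Nat.factorial_succ, add_tsub_cancel_right,
    show ν + (k + 1 : ℕ) + 1 = ν + 1 + k + 1 by push_cast; ring]
  have : Complex.Gamma (ν + 1 + k + 1) ≠ 0 :=
    Gamma_add_nat_add_one_ne_zero (by simp; linarith) k
  have hk : (k : ℂ) + 1 ≠ 0 := Nat.cast_add_one_ne_zero k
  have hf : (Nat.factorial k : ℂ) ≠ 0 := by exact_mod_cast Nat.factorial_ne_zero k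
  push_cast
  field_simp
  ring

/-- The three-term recurrence of the Bessel–Clifford functions, which together with
`hasDerivAt_besselClifford` is Bessel's differential equation. -/
theorem besselClifford_recurrence {ν : ℂ} (hν : -1 < ν.re) (z : ℂ) :
    z * besselClifford (ν + 2) z - (ν + 1) * besselClifford (ν + 1) z + besselClifford ν z = 0 := by
  have s0 := summable_besselClifford hν z
  have s1 := summable_besselClifford (ν := ν + 1) (by simp; linarith) z
  have s2 := summable_besselClifford (ν := ν + 2) (by simp; linarith) z
  have e : (ν + 1) * besselClifford (ν + 1) z - besselClifford ν z =
      z * besselClifford (ν + 2) z := by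
    unfold besselClifford
    rw [← tsum_mul_left, ← tsum_mul_left, ← (s1.mul_left _).tsum_sub s0,
      ((s1.mul_left (ν + 1)).sub s0).tsum_eq_zero_add]
    have h0 : Complex.Gamma (ν + 1 + 1) = (ν + 1) * Complex.Gamma (ν + 1) := by
      have := Gamma_add_nat_succ hν 0
      simpa using this
    have hz0 : Complex.Gamma (ν + 1) ≠ 0 := by simpa using Gamma_add_nat_add_one_ne_zero hν 0
    have hz1 : ν + 1 ≠ 0 := by simpa using add_nat_add_one_ne_zero hν 0
    have : (ν + 1) * ((-1 : ℂ) ^ 0 * z ^ 0 / ((Nat.factorial 0 : ℂ) *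
        Complex.Gamma (ν + 1 + (0 : ℕ) + 1))) - (-1 : ℂ) ^ 0 * z ^ 0 / ((Nat.factorial 0 : ℂ) *
        Complex.Gamma (ν + (0 : ℕ) + 1)) = 0 := by
      simp [h0]
      field_simp
      simp
    rw [this, zero_add]
    refine tsum_congr fun k => ?_
    have g1 : ν + 1 + (k + 1 : ℕ) + 1 = ν + 2 + k + 1 := by push_cast; ring
    have g2 : Complex.Gamma (ν + 2 + k + 1) =
        (ν + (k + 1 : ℕ) + 1) * Complex.Gamma (ν + (k + 1 : ℕ) + 1) := by
      rw [← Gamma_add_nat_succ hν (k + 1)]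
      push_cast
      ring_nf
    rw [g1, g2, Nat.factorial_succ]
    have n1 := add_nat_add_one_ne_zero hν (k + 1)
    have n2 := Gamma_add_nat_add_one_ne_zero hν (k + 1)
    have hk : (k : ℂ) + 1 ≠ 0 := Nat.cast_add_one_ne_zero k
    have hf : (Nat.factorial k : ℂ) ≠ 0 := by exact_mod_cast Nat.factorial_ne_zero k
    generalize Complex.Gamma (ν + (k + 1 : ℕ) + 1) = G at *
    push_cast at *
    field_simp
    ring
  linear_combination -e

theorem continuous_besselClifford {ν : ℂ} (hν : -1 < ν.re) : Continuous (besselClifford ν) :=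
  continuous_iff_continuousAt.2 fun z => (hasDerivAt_besselClifford hν z).continuousAt

/-! ### Bessel's equation and the energy -/

/-- The function `√t J_ν(t)`, written for `t > 0` as `2^(-ν) t^(ν+1/2) C_ν(t²/4)`. -/
noncomputable def rootBessel (ν : ℂ) (t : ℝ) : ℂ :=
  (2 : ℂ) ^ (-ν) * (t : ℂ) ^ (ν + 1 / 2) * besselClifford ν ((t ^ 2 / 4 : ℝ) : ℂ)

/-- The derivative of `t ↦ √t J_ν(t)` on `(0, ∞)`. -/
noncomputable def rootBesselDeriv (ν : ℂ) (t : ℝ) : ℂ :=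
  (2 : ℂ) ^ (-ν) * (t : ℂ) ^ (ν + 1 / 2) *
    ((ν + 1 / 2) / t * besselClifford ν ((t ^ 2 / 4 : ℝ) : ℂ) -
      t / 2 * besselClifford (ν + 1) ((t ^ 2 / 4 : ℝ) : ℂ))

theorem ofReal_sqrt_eq_cpow {t : ℝ} (ht : 0 ≤ t) : ((√t : ℝ) : ℂ) = (t : ℂ) ^ (1 / 2 : ℂ) := by
  rw [Real.sqrt_eq_rpow, Complex.ofReal_cpow ht]
  norm_num

theorem sqrt_mul_besselJ (ν : ℂ) {t : ℝ} (ht : 0 < t) :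
    ((√t : ℝ) : ℂ) * besselJ ν t = rootBessel ν t := by
  have h0 : (t : ℂ) ≠ 0 := by exact_mod_cast ht.ne'
  have h2 : ((t / 2 : ℝ) : ℂ) ^ ν = (t : ℂ) ^ ν * (2 : ℂ) ^ (-ν) := by
    rw [div_eq_mul_inv, Complex.ofReal_mul, Complex.mul_cpow_ofReal_nonneg ht.le (by norm_num),
      Complex.cpow_neg, ← Complex.inv_cpow]
    · norm_num
    · rw [show (2 : ℂ) = ((2 : ℝ) : ℂ) by norm_num, Complex.arg_ofReal_of_nonneg (by norm_num)]
      exact Real.pi_pos.ne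
  rw [besselJ, rootBessel, besselClifford, h2, ofReal_sqrt_eq_cpow ht.le, Complex.cpow_add _ _ h0]
  have : ∀ k : ℕ, ((t / 2 : ℝ) : ℂ) ^ (2 * k) = ((t ^ 2 / 4 : ℝ) : ℂ) ^ k := by
    intro k
    rw [pow_mul]
    congr 1
    push_cast
    ring
  simp_rw [this]
  ring

theorem hankelKernel_eq (ν : ℂ) {x y : ℝ} (hx : 0 < x) (hy : 0 < y) :
    hankelKernel ν x y = rootBessel ν (x * y) :=
  sqrt_mul_besselJ ν (mul_pos hx hy)

theorem hasDerivAt_besselClifford_sq {ν : ℂ} (hν : -1 < ν.re) (t : ℝ) :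
    HasDerivAt (fun t : ℝ => besselClifford ν ((t ^ 2 / 4 : ℝ) : ℂ))
      (-(t / 2) * besselClifford (ν + 1) ((t ^ 2 / 4 : ℝ) : ℂ)) t := by
  have h1 : HasDerivAt (fun t : ℝ => ((t ^ 2 / 4 : ℝ) : ℂ)) ((t / 2 : ℝ) : ℂ) t := by
    apply HasDerivAt.ofReal_comp
    refine ((hasDerivAt_pow 2 t).div_const 4).congr_deriv ?_
    norm_num
    ring
  have := (hasDerivAt_besselClifford hν ((t ^ 2 / 4 : ℝ) : ℂ)).comp_of_eq t h1 rfl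
  refine this.congr_deriv ?_
  push_cast
  ring

theorem hasDerivAt_ofReal_cpow_div {t : ℝ} (ht : 0 < t) (r : ℂ) :
    HasDerivAt (fun t : ℝ => (t : ℂ) ^ r) ((t : ℂ) ^ r * (r / t)) t := by
  have h0 : (t : ℂ) ≠ 0 := by exact_mod_cast ht.ne'
  have h := (hasDerivAt_id (t : ℂ)).cpow_const (c := r) (Or.inl (by simpa using ht))
  have := h.comp_ofReal
  refine this.congr_deriv ?_
  simp only [id]
  rw [Complex.cpow_sub _ _ h0, Complex.cpow_one]
  ring

theorem hasDerivAt_rootBessel {ν : ℂ} (hν : -1 < ν.re) {t : ℝ} (ht : 0 < t) :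
    HasDerivAt (rootBessel ν) (rootBesselDeriv ν t) t := by
  have := ((hasDerivAt_ofReal_cpow_div ht (ν + 1 / 2)).const_mul ((2 : ℂ) ^ (-ν))).mul
    (hasDerivAt_besselClifford_sq hν t)
  refine this.congr_deriv ?_
  rw [rootBesselDeriv]
  ring

/-- Bessel's equation in normal form: `v = √t J_ν(t)` solves `v'' = ((ν² - 1/4)/t² - 1) v`. -/
theorem hasDerivAt_rootBesselDeriv {ν : ℂ} (hν : -1 < ν.re) {t : ℝ} (ht : 0 < t) :
    HasDerivAt (rootBesselDeriv ν) (((ν ^ 2 - 1 / 4) / t ^ 2 - 1) * rootBessel ν t) t := by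
  have h0 : (t : ℂ) ≠ 0 := by exact_mod_cast ht.ne'
  have hν1 : -1 < (ν + 1).re := by simp; linarith
  have hid : HasDerivAt (fun t : ℝ => (t : ℂ)) 1 t := (hasDerivAt_id t).ofReal_comp
  have h := ((hasDerivAt_ofReal_cpow_div ht (ν + 1 / 2)).const_mul ((2 : ℂ) ^ (-ν))).mul
    ((((hasDerivAt_const t (ν + 1 / 2)).div hid h0).mul (hasDerivAt_besselClifford_sq hν t)).sub
      ((hid.div_const 2).mul (hasDerivAt_besselClifford_sq hν1 t)))
  refine h.congr_deriv ?_
  rw [rootBessel]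
  have hr := besselClifford_recurrence hν ((t ^ 2 / 4 : ℝ) : ℂ)
  rw [show ν + 1 + 1 = ν + 2 by ring]
  simp only [Pi.div_apply, Pi.mul_apply, Pi.sub_apply]
  push_cast at hr ⊢
  have e : besselClifford ν ((t : ℂ) ^ 2 / 4) = (ν + 1) * besselClifford (ν + 1) ((t : ℂ) ^ 2 / 4)
      - (t : ℂ) ^ 2 / 4 * besselClifford (ν + 2) ((t : ℂ) ^ 2 / 4) := by
    linear_combination hr
  rw [e]
  field_simp
  ring

/-- The energy `|v|² + |v'|²` of `v = √t J_ν(t)`. -/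
noncomputable def besselEnergy (ν : ℂ) (t : ℝ) : ℝ :=
  ‖rootBessel ν t‖ ^ 2 + ‖rootBesselDeriv ν t‖ ^ 2

open scoped ComplexConjugate in
theorem hasDerivAt_normSq {f : ℝ → ℂ} {f' : ℂ} {t : ℝ} (h : HasDerivAt f f' t) :
    HasDerivAt (fun t => ‖f t‖ ^ 2) (2 * (f' * conj (f t)).re) t := by
  refine h.norm_sq.congr_deriv ?_
  rw [Complex.inner]

open scoped ComplexConjugate in
theorem hasDerivAt_besselEnergy {ν : ℂ} (hν : -1 < ν.re) {t : ℝ} (ht : 0 < t) :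
    HasDerivAt (besselEnergy ν)
      (2 * ((ν ^ 2 - 1 / 4) / t ^ 2 * (rootBessel ν t * conj (rootBesselDeriv ν t))).re) t := by
  refine ((hasDerivAt_normSq (hasDerivAt_rootBessel hν ht)).add
    (hasDerivAt_normSq (hasDerivAt_rootBesselDeriv hν ht))).congr_deriv ?_
  generalize rootBessel ν t = a
  generalize rootBesselDeriv ν t = b
  generalize (ν ^ 2 - 1 / 4) / (t : ℂ) ^ 2 = q
  simp only [Complex.mul_re, Complex.mul_im, Complex.conj_re, Complex.conj_im, Complex.sub_re,
    Complex.sub_im, Complex.one_re, Complex.one_im]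
  ring

open scoped ComplexConjugate in
theorem abs_deriv_besselEnergy_le (ν : ℂ) (t : ℝ) :
    |2 * ((ν ^ 2 - 1 / 4) / t ^ 2 * (rootBessel ν t * conj (rootBesselDeriv ν t))).re| ≤
      ‖ν ^ 2 - 1 / 4‖ / t ^ 2 * besselEnergy ν t := by
  rw [abs_mul, abs_two]
  have h := Complex.abs_re_le_norm
    ((ν ^ 2 - 1 / 4) / t ^ 2 * (rootBessel ν t * conj (rootBesselDeriv ν t)))
  rw [norm_mul, norm_mul, norm_div, norm_pow, Complex.norm_real, Complex.norm_conj,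
    Real.norm_eq_abs, sq_abs] at h
  have hq : 0 ≤ ‖ν ^ 2 - 1 / 4‖ / t ^ 2 := by positivity
  unfold besselEnergy
  nlinarith [mul_nonneg hq (sq_nonneg (‖rootBessel ν t‖ - ‖rootBesselDeriv ν t‖))]

theorem hasDerivAt_exp_div (c : ℝ) {t : ℝ} (ht : 0 < t) :
    HasDerivAt (fun t => Real.exp (c / t)) (Real.exp (c / t) * (-c / t ^ 2)) t := by
  have := ((hasDerivAt_const t c).div (hasDerivAt_id t) ht.ne').exp
  refine this.congr_deriv ?_
  simp

/-- Since the potential `(ν² - 1/4)/t²` is integrable at infinity, the energy varies by a bounded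
factor; here the growth is controlled. -/
theorem antitoneOn_besselEnergy_mul_exp {ν : ℂ} (hν : -1 < ν.re) :
    AntitoneOn (fun t => besselEnergy ν t * Real.exp (‖ν ^ 2 - 1 / 4‖ / t)) (Ioi 0) := by
  have hd : ∀ t ∈ Ioi (0 : ℝ), HasDerivAt
      (fun t => besselEnergy ν t * Real.exp (‖ν ^ 2 - 1 / 4‖ / t)) _ t := fun t ht =>
    (hasDerivAt_besselEnergy hν ht).mul (hasDerivAt_exp_div ‖ν ^ 2 - 1 / 4‖ ht)
  refine antitoneOn_of_deriv_nonpos (convex_Ioi 0)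
    (fun t ht => (hd t ht).continuousAt.continuousWithinAt)
    (fun t ht => (hd t (interior_subset ht)).differentiableAt.differentiableWithinAt) ?_
  intro t ht
  rw [(hd t (interior_subset ht)).deriv]
  have h := (abs_le.1 (abs_deriv_besselEnergy_le ν t)).2
  have he := Real.exp_pos (‖ν ^ 2 - 1 / 4‖ / t)
  rw [neg_div]
  nlinarith [mul_le_mul_of_nonneg_right h he.le]

/-- The energy cannot decay by more than a bounded factor. -/
theorem monotoneOn_besselEnergy_mul_exp {ν : ℂ} (hν : -1 < ν.re) :
    MonotoneOn (fun t => besselEnergy ν t * Real.exp (-‖ν ^ 2 - 1 / 4‖ / t)) (Ioi 0) := by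
  have hd : ∀ t ∈ Ioi (0 : ℝ), HasDerivAt
      (fun t => besselEnergy ν t * Real.exp (-‖ν ^ 2 - 1 / 4‖ / t)) _ t := fun t ht =>
    (hasDerivAt_besselEnergy hν ht).mul (hasDerivAt_exp_div (-‖ν ^ 2 - 1 / 4‖) ht)
  refine monotoneOn_of_deriv_nonneg (convex_Ioi 0)
    (fun t ht => (hd t ht).continuousAt.continuousWithinAt)
    (fun t ht => (hd t (interior_subset ht)).differentiableAt.differentiableWithinAt) ?_
  intro t ht
  rw [(hd t (interior_subset ht)).deriv]
  have h := (abs_le.1 (abs_deriv_besselEnergy_le ν t)).1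
  have he := Real.exp_pos (-‖ν ^ 2 - 1 / 4‖ / t)
  rw [neg_neg]
  nlinarith [mul_le_mul_of_nonneg_right h he.le]

theorem besselEnergy_nonneg (ν : ℂ) (t : ℝ) : 0 ≤ besselEnergy ν t := by
  unfold besselEnergy
  positivity

theorem rootBessel_eq_zero_iff (ν : ℂ) {t : ℝ} (ht : 0 < t) :
    rootBessel ν t = 0 ↔ besselClifford ν ((t ^ 2 / 4 : ℝ) : ℂ) = 0 := by
  have h0 : (t : ℂ) ≠ 0 := by exact_mod_cast ht.ne'
  simp [rootBessel, Complex.cpow_eq_zero_iff, h0]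

/-- A solution with vanishing energy would vanish identically, but `C_ν(0) = 1/Γ(ν+1) ≠ 0`. -/
theorem besselEnergy_pos {ν : ℂ} (hν : -1 < ν.re) {t : ℝ} (ht : 0 < t) : 0 < besselEnergy ν t := by
  refine (besselEnergy_nonneg ν t).lt_of_ne' fun h => ?_
  have hz : ∀ s : ℝ, 0 < s → s ≤ t → besselClifford ν ((s ^ 2 / 4 : ℝ) : ℂ) = 0 := by
    intro s hs hst
    have h1 := monotoneOn_besselEnergy_mul_exp hν hs ht hst
    simp only [h, zero_mul] at h1
    have h2 : besselEnergy ν s ≤ 0 := nonpos_of_mul_nonpos_left h1 (Real.exp_pos _)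
    rw [← rootBessel_eq_zero_iff ν hs]
    have h3 : ‖rootBessel ν s‖ ^ 2 ≤ 0 := by
      unfold besselEnergy at h2
      nlinarith [sq_nonneg ‖rootBesselDeriv ν s‖]
    simpa using le_antisymm h3 (sq_nonneg _)
  have hc : Continuous fun s : ℝ => besselClifford ν ((s ^ 2 / 4 : ℝ) : ℂ) :=
    (continuous_besselClifford hν).comp (by fun_prop)
  have hlim : Tendsto (fun s : ℝ => besselClifford ν ((s ^ 2 / 4 : ℝ) : ℂ)) (𝓝[>] 0)
      (𝓝 (besselClifford ν (((0 : ℝ) ^ 2 / 4 : ℝ) : ℂ))) :=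
    (hc.tendsto 0).mono_left nhdsWithin_le_nhds
  have hlim0 : Tendsto (fun s : ℝ => besselClifford ν ((s ^ 2 / 4 : ℝ) : ℂ)) (𝓝[>] 0) (𝓝 0) := by
    refine tendsto_const_nhds.congr' ?_
    filter_upwards [Ioc_mem_nhdsGT ht] with s hs
    exact (hz s hs.1 hs.2).symm
  have := tendsto_nhds_unique hlim hlim0
  have hG : Complex.Gamma (ν + 1) ≠ 0 := by simpa using Gamma_add_nat_add_one_ne_zero hν 0
  simp [besselClifford_zero, hG] at this

theorem exists_besselEnergy_bounds {ν : ℂ} (hν : -1 < ν.re) :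
    ∃ c C : ℝ, 0 < c ∧ 0 < C ∧ ∀ t : ℝ, 1 ≤ t → c ≤ besselEnergy ν t ∧ besselEnergy ν t ≤ C := by
  set k := ‖ν ^ 2 - 1 / 4‖ with hk
  have hk0 : 0 ≤ k := norm_nonneg _
  have hE := besselEnergy_pos hν one_pos
  refine ⟨besselEnergy ν 1 * Real.exp (-k), besselEnergy ν 1 * Real.exp k, by positivity,
    by positivity, fun t ht => ?_⟩
  have ht0 : 0 < t := by linarith
  have h1 := antitoneOn_besselEnergy_mul_exp hν (mem_Ioi.2 one_pos) (mem_Ioi.2 ht0) ht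
  have h2 := monotoneOn_besselEnergy_mul_exp hν (mem_Ioi.2 one_pos) (mem_Ioi.2 ht0) ht
  simp only [← hk, div_one] at h1 h2
  have hEt := besselEnergy_nonneg ν t
  constructor
  · refine h2.trans (mul_le_of_le_one_right hEt (Real.exp_le_one_iff.2 ?_))
    rw [neg_div]
    have : 0 ≤ k / t := by positivity
    linarith
  · exact (le_mul_of_one_le_right hEt (Real.one_le_exp (by positivity))).trans h1

theorem continuousOn_rootBessel {ν : ℂ} (hν : -1 < ν.re) : ContinuousOn (rootBessel ν) (Ioi 0) :=
  fun _ ht => (hasDerivAt_rootBessel hν ht).continuousAt.continuousWithinAt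

theorem exists_rootBessel_ne_zero {ν : ℂ} (hν : -1 < ν.re) {a b : ℝ} (ha : 0 < a) (hab : a < b) :
    ∃ t ∈ Ioo a b, rootBessel ν t ≠ 0 := by
  by_contra! h
  have hm : (a + b) / 2 ∈ Ioo a b := ⟨by linarith, by linarith⟩
  have hm0 : 0 < (a + b) / 2 := by linarith
  have h1 : rootBessel ν =ᶠ[𝓝 ((a + b) / 2)] fun _ => 0 := by
    filter_upwards [isOpen_Ioo.mem_nhds hm] with t ht using h t ht
  have h2 : rootBesselDeriv ν ((a + b) / 2) = 0 :=
    (hasDerivAt_rootBessel hν hm0).unique ((hasDerivAt_const _ _).congr_of_eventuallyEq h1)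
  have := besselEnergy_pos hν hm0
  simp [besselEnergy, h2, h _ hm] at this

/-! ### Upper and lower bounds for the Bessel kernel -/

theorem min_rpow_le_rpow {p q x : ℝ} (s : ℝ) (hp : 0 < p) (hx : x ∈ Icc p q) :
    min (p ^ s) (q ^ s) ≤ x ^ s := by
  have hx0 : 0 < x := hp.trans_le hx.1
  rcases le_total 0 s with hs | hs
  · exact (min_le_left _ _).trans (Real.rpow_le_rpow hp.le hx.1 hs)
  · exact (min_le_right _ _).trans (Real.rpow_le_rpow_of_nonpos hx0 hx.2 hs)

theorem min_one_mul_rpow_le {x y : ℝ} (s : ℝ) (hx : 0 < x) (hy : 0 < y) :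
    (min 1 (x * y)) ^ s ≤ (min 1 x) ^ s * (1 + y ^ s) := by
  have hm : 0 < min 1 x := lt_min one_pos hx
  have hxy : 0 < x * y := mul_pos hx hy
  have hw : 0 ≤ min 1 x ^ s := by positivity
  have hys : 0 ≤ y ^ s := by positivity
  have key : ∀ z : ℝ, 0 < z → z ^ s ≤ 1 + y ^ s →
      (min 1 (x * y)) ^ s ≤ (min 1 x * z) ^ s →
      (min 1 (x * y)) ^ s ≤ (min 1 x) ^ s * (1 + y ^ s) := by
    intro z hz h1 h2
    rw [Real.mul_rpow hm.le hz.le] at h2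
    exact h2.trans (mul_le_mul_of_nonneg_left h1 hw)
  rcases le_total 0 s with hs | hs
  · refine key (max 1 y) (by positivity) ?_ (Real.rpow_le_rpow (by positivity) ?_ hs)
    · rcases max_choice 1 y with h | h <;> rw [h]
      · rw [Real.one_rpow]
        linarith
      · linarith
    · rcases le_total 1 x with h | h
      · rw [min_eq_left h, one_mul]
        exact (min_le_left _ _).trans (le_max_left _ _)
      · rw [min_eq_right h]
        exact (min_le_right _ _).trans (mul_le_mul_of_nonneg_left (le_max_right _ _) hx.le)
  · refine key (min 1 y) (by positivity) ?_
      (Real.rpow_le_rpow_of_nonpos (by positivity) ?_ hs)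
    · rcases min_choice 1 y with h | h <;> rw [h]
      · rw [Real.one_rpow]
        linarith
      · linarith
    · have h1 : min 1 x ≤ 1 := min_le_left _ _
      have h2 : min 1 x ≤ x := min_le_right _ _
      have h3 : min 1 y ≤ 1 := min_le_left _ _
      have h4 : min 1 y ≤ y := min_le_right _ _
      have h5 : 0 < min 1 y := by positivity
      exact le_min (by nlinarith) (mul_le_mul h2 h4 h5.le hx.le)

theorem norm_rootBessel (ν : ℂ) {t : ℝ} (ht : 0 < t) :
    ‖rootBessel ν t‖ =
      ‖(2 : ℂ) ^ (-ν)‖ * t ^ (ν.re + 1 / 2) * ‖besselClifford ν ((t ^ 2 / 4 : ℝ) : ℂ)‖ := by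
  rw [rootBessel, norm_mul, norm_mul, Complex.norm_cpow_eq_rpow_re_of_pos ht]
  norm_num

/-- Near `0` the bound comes from the power series, on `[1, ∞)` from the energy. -/
theorem exists_norm_rootBessel_le {ν : ℂ} (hν : -1 < ν.re) :
    ∃ C : ℝ, 0 < C ∧ ∀ t : ℝ, 0 < t → ‖rootBessel ν t‖ ≤ C * (min 1 t) ^ (ν.re + 1 / 2) := by
  obtain ⟨c, C, -, hC, hE⟩ := exists_besselEnergy_bounds hν
  have hc : Continuous fun s : ℝ => besselClifford ν ((s ^ 2 / 4 : ℝ) : ℂ) :=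
    (continuous_besselClifford hν).comp (by fun_prop)
  obtain ⟨B, hB⟩ := (isCompact_Icc (a := (0 : ℝ)) (b := 1)).exists_bound_of_continuousOn
    hc.continuousOn
  have hB0 : 0 ≤ B := (norm_nonneg _).trans (hB 0 (by simp))
  refine ⟨‖(2 : ℂ) ^ (-ν)‖ * B + (1 + C), by positivity, fun t ht => ?_⟩
  rcases le_total t 1 with h | h
  · rw [min_eq_right h, norm_rootBessel ν ht]
    have hts : 0 ≤ t ^ (ν.re + 1 / 2) := by positivity
    calc _ ≤ ‖(2 : ℂ) ^ (-ν)‖ * t ^ (ν.re + 1 / 2) * B := by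
          gcongr
          exact hB t ⟨ht.le, h⟩
      _ = (‖(2 : ℂ) ^ (-ν)‖ * B) * t ^ (ν.re + 1 / 2) := by ring
      _ ≤ _ := by
        gcongr
        linarith
  · rw [min_eq_left h, Real.one_rpow, mul_one]
    have h1 := (hE t h).2
    unfold besselEnergy at h1
    have h2 : ‖rootBessel ν t‖ ≤ 1 + C := by
      nlinarith [sq_nonneg ‖rootBesselDeriv ν t‖, sq_nonneg (‖rootBessel ν t‖ - 1),
        norm_nonneg (rootBessel ν t)]
    have : 0 ≤ ‖(2 : ℂ) ^ (-ν)‖ * B := by positivity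
    linarith

theorem exists_norm_rootBessel_mul_le {ν : ℂ} (hν : -1 < ν.re) :
    ∃ C : ℝ, 0 < C ∧ ∀ x y : ℝ, 0 < x → 0 < y →
      ‖rootBessel ν (x * y)‖ ≤
        C * ((min 1 x) ^ (ν.re + 1 / 2) * (1 + y ^ (ν.re + 1 / 2))) := by
  obtain ⟨C, hC, h⟩ := exists_norm_rootBessel_le hν
  refine ⟨C, hC, fun x y hx hy => (h _ (mul_pos hx hy)).trans ?_⟩
  gcongr
  exact min_one_mul_rpow_le _ hx hy

theorem continuousOn_rootBessel_mul {ν : ℂ} (hν : -1 < ν.re) {x a b : ℝ} (hx : 0 < x) (ha : 0 < a) :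
    ContinuousOn (fun y => rootBessel ν (x * y)) (Icc a b) :=
  (continuousOn_rootBessel hν).comp (by fun_prop) fun _ hy => mul_pos hx (ha.trans_le hy.1)

open scoped ComplexConjugate in
/-- For `v = √t J_ν(t)`, the derivative of `Re (v' v̄)` is `|v'|² - |v|²` up to a small error. So
`|v|²` and `|v'|²` have nearly the same mean over long intervals, and the lower bound of the energy
carries over to `|v|²`. -/
theorem exists_le_integral_rootBessel_of_large {ν : ℂ} (hν : -1 < ν.re) {a b : ℝ} (ha : 0 < a)
    (hab : a < b) :
    ∃ c R : ℝ, 0 < c ∧ 1 ≤ R ∧ ∀ x : ℝ, R ≤ x → c ≤ ∫ y in a..b, ‖rootBessel ν (x * y)‖ := by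
  obtain ⟨c, C, hc, hC, hE⟩ := exists_besselEnergy_bounds hν
  set k := ‖ν ^ 2 - 1 / 4‖ with hk
  have hk0 : 0 ≤ k := norm_nonneg _
  set D : ℝ → ℝ := fun t => (rootBesselDeriv ν t * conj (rootBessel ν t)).re with hD
  have hDderiv : ∀ t : ℝ, 0 < t → HasDerivAt D
      (((ν ^ 2 - 1 / 4) / (t : ℂ) ^ 2).re * ‖rootBessel ν t‖ ^ 2 - ‖rootBessel ν t‖ ^ 2
        + ‖rootBesselDeriv ν t‖ ^ 2) t := by
    intro t ht
    have h := (hasDerivAt_rootBesselDeriv hν ht).mul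
      ((Complex.conjCLE.toContinuousLinearMap.hasFDerivAt.comp_hasDerivAt t
        (hasDerivAt_rootBessel hν ht)))
    have h2 := (Complex.reCLM.hasFDerivAt.comp_hasDerivAt t h)
    refine h2.congr_deriv ?_
    simp only [Complex.reCLM_apply, Function.comp, ContinuousLinearEquiv.coe_coe,
      Complex.conjCLE_apply]
    generalize rootBessel ν t = p
    generalize rootBesselDeriv ν t = q
    generalize (ν ^ 2 - 1 / 4) / (t : ℂ) ^ 2 = r
    rw [Complex.sq_norm, Complex.sq_norm, Complex.normSq_apply, Complex.normSq_apply]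
    simp only [Complex.mul_re, Complex.mul_im, Complex.conj_re, Complex.conj_im, Complex.sub_re,
      Complex.sub_im, Complex.one_re, Complex.one_im, Complex.add_re]
    ring
  have hDle : ∀ t : ℝ, 1 ≤ t → |D t| ≤ C := by
    intro t ht
    have h1 := Complex.abs_re_le_norm (rootBesselDeriv ν t * conj (rootBessel ν t))
    rw [norm_mul, Complex.norm_conj] at h1
    have h2 := (hE t ht).2
    unfold besselEnergy at h2
    nlinarith [sq_nonneg (‖rootBessel ν t‖ - ‖rootBesselDeriv ν t‖),
      sq_nonneg (‖rootBessel ν t‖ + ‖rootBesselDeriv ν t‖)]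
  -- beyond `R` both the boundary terms and the error from the potential are below `c (b - a) / 4`
  set R : ℝ := 1 + 1 / a + 4 * k * C / (c * a) + 8 * C / (c * (b - a)) with hR
  have hba : 0 < b - a := by linarith
  have hR1 : 1 ≤ R := by
    have : 0 ≤ 1 / a + 4 * k * C / (c * a) + 8 * C / (c * (b - a)) := by positivity
    linarith
  refine ⟨c * (b - a) / 2 / (2 * (1 + C)), R, by positivity, hR1, fun x hx => ?_⟩
  have hx1 : 1 ≤ x := hR1.trans hx
  have hx0 : 0 < x := by linarith
  have hxa : 1 / a ≤ x := by
    have : 0 ≤ 4 * k * C / (c * a) + 8 * C / (c * (b - a)) := by positivity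
    linarith
  have hxa' : 1 ≤ x * a := by rwa [div_le_iff₀ ha] at hxa
  have hxk : 4 * k * C ≤ c * (x * a) := by
    have : 4 * k * C / (c * a) ≤ x := by
      have : 0 ≤ 1 / a + 8 * C / (c * (b - a)) := by positivity
      linarith
    rw [div_le_iff₀ (by positivity)] at this
    linarith
  have hxC : 8 * C ≤ c * (b - a) * x := by
    have : 8 * C / (c * (b - a)) ≤ x := by
      have : 0 ≤ 1 / a + 4 * k * C / (c * a) := by positivity
      linarith
    rw [div_le_iff₀ (by positivity)] at this
    linarith
  have hcont := continuousOn_rootBessel_mul hν (b := b) hx0 ha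
  have key := intervalIntegral.sub_le_integral_of_hasDeriv_right_of_le (a := a) (b := b)
    (g := fun y => (c - c / 4) * y - D (x * y) / x)
    (g' := fun y => (c - c / 4) - (((ν ^ 2 - 1 / 4) / ((x * y : ℝ) : ℂ) ^ 2).re *
      ‖rootBessel ν (x * y)‖ ^ 2 - ‖rootBessel ν (x * y)‖ ^ 2 + ‖rootBesselDeriv ν (x * y)‖ ^ 2))
    (φ := fun y => 2 * (1 + C) * ‖rootBessel ν (x * y)‖) hab.le ?_ ?_ ?_ ?_
  · rw [intervalIntegral.integral_const_mul] at key
    have h1 := (abs_le.1 (hDle (x * b) (by nlinarith))).2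
    have h2 := (abs_le.1 (hDle (x * a) hxa')).1
    have h3 : (D (x * b) - D (x * a)) / x ≤ c * (b - a) / 4 := by
      rw [div_le_iff₀ hx0]
      linarith
    rw [div_le_iff₀ (by positivity)]
    rw [sub_div] at h3
    have : 0 < c * (b - a) := by positivity
    linarith
  · refine ContinuousOn.sub (by fun_prop) (ContinuousOn.div_const ?_ _)
    intro y hy
    have hy0 : 0 < y := ha.trans_le hy.1
    have h := (hDderiv (x * y) (by positivity)).continuousAt
    exact (ContinuousAt.comp (f := fun y => x * y) h (by fun_prop)).continuousWithinAt
  · intro y hy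
    have hy0 : 0 < y := ha.trans hy.1
    have h1 := (hDderiv (x * y) (by positivity)).comp y ((hasDerivAt_id y).const_mul x)
    have h2 := ((hasDerivAt_id y).const_mul (c - c / 4)).sub (h1.div_const x)
    refine (h2.congr_deriv ?_).hasDerivWithinAt
    rw [mul_one, mul_one, mul_div_cancel_right₀ _ hx0.ne']
  · exact (continuousOn_const.mul hcont.norm).integrableOn_Icc
  · intro y hy
    have hy0 : 0 < y := ha.trans hy.1
    have hxy : x * a ≤ x * y := by gcongr; exact hy.1.le
    have hxy1 : 1 ≤ x * y := hxa'.trans hxy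
    obtain ⟨h1, h2⟩ := hE (x * y) hxy1
    have h3 := (abs_le.1 (Complex.abs_re_le_norm
      ((ν ^ 2 - 1 / 4) / ((x * y : ℝ) : ℂ) ^ 2))).1
    rw [norm_div, norm_pow, Complex.norm_real, Real.norm_eq_abs, sq_abs, ← hk] at h3
    have h4 : k / (x * y) ^ 2 * C ≤ c / 4 := by
      rw [div_mul_eq_mul_div, div_le_iff₀ (by positivity)]
      have : x * y ≤ (x * y) ^ 2 := by nlinarith
      nlinarith
    unfold besselEnergy at h1 h2
    have h5 := sq_nonneg ‖rootBesselDeriv ν (x * y)‖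
    have h6 := norm_nonneg (rootBessel ν (x * y))
    have h7 : ‖rootBessel ν (x * y)‖ ≤ 1 + C := by
      nlinarith [sq_nonneg (‖rootBessel ν (x * y)‖ - 1)]
    have h8 : k / (x * y) ^ 2 * ‖rootBessel ν (x * y)‖ ^ 2 ≤ c / 4 :=
      (mul_le_mul_of_nonneg_left (by linarith) (by positivity)).trans h4
    have h9 := mul_le_mul_of_nonneg_right h3 (sq_nonneg ‖rootBessel ν (x * y)‖)
    nlinarith

/-- For bounded `x` the mean of `|C_ν((xy)²/4)|` over `[a, b]` is continuous and positive in `x`,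
also at `x = 0`, so compactness gives the lower bound. -/
theorem exists_le_integral_rootBessel_of_small {ν : ℂ} (hν : -1 < ν.re) {a b : ℝ} (ha : 0 < a)
    (hab : a < b) (R : ℝ) :
    ∃ c : ℝ, 0 < c ∧ ∀ x : ℝ, 0 < x → x ≤ R →
      c * x ^ (ν.re + 1 / 2) ≤ ∫ y in a..b, ‖rootBessel ν (x * y)‖ := by
  rcases le_or_gt R 0 with hR0 | hR0
  · exact ⟨1, one_pos, fun x hx hxR => absurd hx (by linarith)⟩
  set Φ : ℝ → ℝ := fun x => ∫ y in a..b, ‖besselClifford ν (((x * y) ^ 2 / 4 : ℝ) : ℂ)‖ with hΦ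
  have hc1 : Continuous fun t : ℝ => ‖besselClifford ν ((t ^ 2 / 4 : ℝ) : ℂ)‖ :=
    ((continuous_besselClifford hν).comp (by fun_prop)).norm
  have hc2 : Continuous fun p : ℝ × ℝ => ‖besselClifford ν (((p.1 * p.2) ^ 2 / 4 : ℝ) : ℂ)‖ :=
    hc1.comp (g := fun t : ℝ => ‖besselClifford ν ((t ^ 2 / 4 : ℝ) : ℂ)‖)
      (f := fun p : ℝ × ℝ => p.1 * p.2) (by fun_prop)
  have hcx : ∀ x : ℝ, Continuous fun y : ℝ => ‖besselClifford ν (((x * y) ^ 2 / 4 : ℝ) : ℂ)‖ :=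
    fun x => hc1.comp (g := fun t : ℝ => ‖besselClifford ν ((t ^ 2 / 4 : ℝ) : ℂ)‖)
      (f := fun y : ℝ => x * y) (by fun_prop)
  have hΦc : Continuous Φ :=
    intervalIntegral.continuous_parametric_intervalIntegral_of_continuous' hc2 a b
  have hΦpos : ∀ x : ℝ, 0 ≤ x → 0 < Φ x := by
    intro x hx
    simp only [hΦ]
    apply intervalIntegral.integral_pos hab (hcx x).continuousOn (fun _ _ => norm_nonneg _)
    rcases hx.eq_or_lt with rfl | hx
    · refine ⟨a, ⟨le_rfl, hab.le⟩, ?_⟩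
      have hG : Complex.Gamma (ν + 1) ≠ 0 := by simpa using Gamma_add_nat_add_one_ne_zero hν 0
      simp [besselClifford_zero, hG]
    · obtain ⟨t, ht, hne⟩ := exists_rootBessel_ne_zero hν (mul_pos hx ha)
        (mul_lt_mul_of_pos_left hab hx)
      have ht0 : 0 < t := (mul_pos hx ha).trans ht.1
      refine ⟨t / x, ⟨?_, ?_⟩, ?_⟩
      · rw [le_div_iff₀ hx]
        linarith [ht.1]
      · rw [div_le_iff₀ hx]
        linarith [ht.2]
      · rw [mul_div_cancel₀ _ hx.ne']
        exact norm_pos_iff.2 fun h => hne ((rootBessel_eq_zero_iff ν ht0).2 h)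
  obtain ⟨x₀, hx₀, hmin⟩ := (isCompact_Icc (a := (0 : ℝ)) (b := R)).exists_isMinOn
    ⟨0, by simp [hR0.le]⟩ hΦc.continuousOn
  have hm := hΦpos x₀ hx₀.1
  set s := ν.re + 1 / 2 with hs
  set d := min (a ^ s) (b ^ s) with hd
  have hb : 0 < b := ha.trans hab
  have hd0 : 0 < d := lt_min (by positivity) (by positivity)
  have h2 : 0 < ‖(2 : ℂ) ^ (-ν)‖ := by simp [Complex.cpow_eq_zero_iff]
  refine ⟨‖(2 : ℂ) ^ (-ν)‖ * d * Φ x₀, mul_pos (mul_pos h2 hd0) hm, fun x hx hxR => ?_⟩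
  have hxs : 0 ≤ x ^ s := by positivity
  calc ‖(2 : ℂ) ^ (-ν)‖ * d * Φ x₀ * x ^ s ≤ ‖(2 : ℂ) ^ (-ν)‖ * d * Φ x * x ^ s := by
        gcongr
        exact isMinOn_iff.1 hmin x ⟨hx.le, hxR⟩
    _ = ∫ y in a..b, (‖(2 : ℂ) ^ (-ν)‖ * d * x ^ s) *
          ‖besselClifford ν (((x * y) ^ 2 / 4 : ℝ) : ℂ)‖ := by
        rw [intervalIntegral.integral_const_mul]
        ring
    _ ≤ _ := by
        have i1 : IntervalIntegrable (fun y => (‖(2 : ℂ) ^ (-ν)‖ * d * x ^ s) *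
            ‖besselClifford ν (((x * y) ^ 2 / 4 : ℝ) : ℂ)‖) volume a b :=
          (continuous_const.mul (hcx x)).intervalIntegrable _ _
        have i2 : IntervalIntegrable (fun y => ‖rootBessel ν (x * y)‖) volume a b :=
          (continuousOn_rootBessel_mul hν hx ha).norm.intervalIntegrable_of_Icc hab.le
        apply intervalIntegral.integral_mono_on hab.le i1 i2
        intro y hy
        have hy0 : 0 < y := ha.trans_le hy.1
        rw [norm_rootBessel ν (mul_pos hx hy0), ← hs, Real.mul_rpow hx.le hy0.le]
        have := min_rpow_le_rpow s ha hy
        calc _ = ‖(2 : ℂ) ^ (-ν)‖ * (x ^ s * d) *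
              ‖besselClifford ν (((x * y) ^ 2 / 4 : ℝ) : ℂ)‖ := by ring
          _ ≤ _ := by gcongr

/-- The mean of `|√(xy) J_ν(xy)|` over an interval of values of `y` is at least a multiple of the
weight `min(1,x)^(Re ν+1/2)`, in spite of the zeros of the Bessel function. -/
theorem exists_le_integral_rootBessel {ν : ℂ} (hν : -1 < ν.re) {a b : ℝ} (ha : 0 < a)
    (hab : a < b) :
    ∃ c : ℝ, 0 < c ∧ ∀ x : ℝ, 0 < x →
      c * (min 1 x) ^ (ν.re + 1 / 2) ≤ ∫ y in a..b, ‖rootBessel ν (x * y)‖ := by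
  obtain ⟨c₁, R, hc₁, hR, h₁⟩ := exists_le_integral_rootBessel_of_large hν ha hab
  obtain ⟨c₂, hc₂, h₂⟩ := exists_le_integral_rootBessel_of_small hν ha hab R
  set s := ν.re + 1 / 2 with hs
  have hR0 : 0 < R := by linarith
  have hm : 0 < min 1 (R ^ s) := lt_min one_pos (by positivity)
  refine ⟨min c₁ (c₂ * min 1 (R ^ s)), lt_min hc₁ (by positivity),
    fun x hx => ?_⟩
  rcases le_total x 1 with h | h
  · rw [min_eq_right h]
    refine le_trans ?_ (h₂ x hx (h.trans hR))
    gcongr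
    exact (min_le_right _ _).trans (mul_le_of_le_one_right hc₂.le (min_le_left _ _))
  rw [min_eq_left h, Real.one_rpow, mul_one]
  rcases le_total x R with h' | h'
  · refine le_trans ?_ (h₂ x hx h')
    refine (min_le_right _ _).trans ?_
    gcongr
    simpa using min_rpow_le_rpow s one_pos ⟨h, h'⟩
  · exact (min_le_left _ _).trans (h₁ x h')

/-! ### Absolute convergence of Hankel transforms -/

theorem measurable_rootBessel {ν : ℂ} (hν : -1 < ν.re) : Measurable (rootBessel ν) := by
  have h1 : Measurable fun t : ℝ => besselClifford ν ((t ^ 2 / 4 : ℝ) : ℂ) :=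
    (continuous_besselClifford hν).measurable.comp (by fun_prop)
  have h2 : Measurable fun t : ℝ => (t : ℂ) ^ (ν + 1 / 2) :=
    Complex.measurable_ofReal.pow_const _
  exact (h2.const_mul _).mul h1

theorem integrableOn_rootBessel_mul {ν : ℂ} {f : ℝ → ℂ}
    (hf : ∀ y : ℝ, 0 < y → IntegrableOn (fun x : ℝ => hankelKernel ν x y * f x) (Ioi 0))
    {y : ℝ} (hy : 0 < y) : IntegrableOn (fun x : ℝ => rootBessel ν (x * y) * f x) (Ioi 0) :=
  (hf y hy).congr_fun (fun x hx => by simp only [hankelKernel_eq ν hx hy]) measurableSet_Ioi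

/-- The zeros in `x` of `√(xy) J_ν(xy)` move with `y`, so that measurability of `f` follows from
that of countably many of the products. -/
theorem aestronglyMeasurable_of_hankel {ν : ℂ} (hν : -1 < ν.re) {f : ℝ → ℂ}
    (hf : ∀ y : ℝ, 0 < y → IntegrableOn (fun x : ℝ => rootBessel ν (x * y) * f x) (Ioi 0)) :
    AEStronglyMeasurable f (volume.restrict (Ioi 0)) := by
  set S : {q : ℚ // 0 < q} → Set ℝ := fun q => {x ∈ Ioi 0 | rootBessel ν (x * (q : ℚ)) ≠ 0} with hS
  have hmeas : ∀ q : {q : ℚ // 0 < q}, Measurable fun x : ℝ => rootBessel ν (x * ((q : ℚ) : ℝ)) :=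
    fun q => (measurable_rootBessel hν).comp (by fun_prop)
  have hSm : ∀ q, MeasurableSet (S q) := fun q =>
    measurableSet_Ioi.inter ((hmeas q) (measurableSet_singleton 0).compl)
  have hU : Ioi (0 : ℝ) ⊆ ⋃ q, S q := by
    intro x hx
    have hx0 : 0 < x := hx
    obtain ⟨t, ht, hne⟩ := exists_rootBessel_ne_zero hν one_pos one_lt_two
    have ht0 : 0 < t := one_pos.trans ht.1
    have hev : ∀ᶠ y in 𝓝 (t / x), 0 < y ∧ rootBessel ν (x * y) ≠ 0 := by
      refine (eventually_gt_nhds (by positivity)).and ?_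
      have hc : ContinuousAt (fun y => rootBessel ν (x * y)) (t / x) := by
        refine ContinuousAt.comp_of_eq (f := fun y => x * y) (y := t)
          (hasDerivAt_rootBessel hν ht0).continuousAt (by fun_prop) (mul_div_cancel₀ _ hx0.ne')
      refine hc.eventually_ne ?_
      rwa [mul_div_cancel₀ _ hx0.ne']
    obtain ⟨_, ⟨q, rfl⟩, hy⟩ := Rat.isDenseEmbedding_coe_real.dense.inter_nhds_nonempty hev
    exact mem_iUnion.2 ⟨⟨q, by exact_mod_cast hy.1⟩, hx, hy.2⟩
  refine AEStronglyMeasurable.mono_measure ?_ (Measure.restrict_mono hU le_rfl)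
  rw [aestronglyMeasurable_iUnion_iff]
  intro q
  have hq : (0 : ℝ) < (q : ℚ) := by exact_mod_cast q.2
  have h1 : AEStronglyMeasurable (fun x : ℝ => rootBessel ν (x * (q : ℚ)) * f x)
      (volume.restrict (S q)) :=
    (hf _ hq).aestronglyMeasurable.mono_measure (Measure.restrict_mono (fun x hx => hx.1) le_rfl)
  have h2 := ((hmeas q).inv.aestronglyMeasurable (μ := volume.restrict (S q))).mul h1
  refine h2.congr ?_
  filter_upwards [ae_restrict_mem (hSm q)] with x hx
  have := hx.2
  simp only [Pi.mul_apply, Pi.inv_apply]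
  field_simp

/-- By Baire's theorem, the pointwise finite integrals are uniformly bounded on some interval. -/
theorem exists_lintegral_rootBessel_le {ν : ℂ} (hν : -1 < ν.re) {f : ℝ → ℂ}
    (hf : ∀ y : ℝ, 0 < y → IntegrableOn (fun x : ℝ => rootBessel ν (x * y) * f x) (Ioi 0)) :
    ∃ (a b : ℝ) (N : ℕ), 0 < a ∧ a < b ∧ ∀ y ∈ Icc a b,
      ∫⁻ x in Ioi (0 : ℝ), ‖rootBessel ν (x * y) * f x‖ₑ ≤ N := by
  set F : ℝ → ENNReal := fun t =>
    ∫⁻ x in Ioi (0 : ℝ), ‖rootBessel ν (x * Real.exp t) * f x‖ₑ with hF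
  have hclosed : ∀ n : ℕ, IsClosed {t | F t ≤ n} := by
    intro n
    refine IsSeqClosed.isClosed fun u t hu hut => ?_
    have h1 : ∀ x ∈ Ioi (0 : ℝ), ‖rootBessel ν (x * Real.exp t) * f x‖ₑ =
        liminf (fun k => ‖rootBessel ν (x * Real.exp (u k)) * f x‖ₑ) atTop := by
      intro x hx
      have hx0 : 0 < x := hx
      refine (Tendsto.liminf_eq ?_).symm
      refine Tendsto.enorm (Tendsto.mul_const _ ?_)
      have hc := (hasDerivAt_rootBessel hν (mul_pos hx0 (Real.exp_pos t))).continuousAt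
      exact hc.tendsto.comp ((Real.continuous_exp.tendsto t).comp hut |>.const_mul x)
    calc F t = ∫⁻ x in Ioi (0 : ℝ),
          liminf (fun k => ‖rootBessel ν (x * Real.exp (u k)) * f x‖ₑ) atTop :=
          setLIntegral_congr_fun measurableSet_Ioi h1
      _ ≤ liminf (fun k => F (u k)) atTop :=
          lintegral_liminf_le' fun k => (hf _ (Real.exp_pos _)).aestronglyMeasurable.enorm
      _ ≤ liminf (fun _ : ℕ => (n : ENNReal)) atTop := liminf_le_liminf (.of_forall hu)
      _ = n := by simp
  have hUnion : ⋃ n : ℕ, {t | F t ≤ n} = univ := by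
    refine eq_univ_of_forall fun t => mem_iUnion.2 ?_
    obtain ⟨n, hn⟩ := ENNReal.exists_nat_gt (hf _ (Real.exp_pos t)).hasFiniteIntegral.ne
    exact ⟨n, hn.le⟩
  obtain ⟨n, t₀, ht₀⟩ := nonempty_interior_of_iUnion_of_closed hclosed hUnion
  rw [mem_interior_iff_mem_nhds, Metric.mem_nhds_iff] at ht₀
  obtain ⟨δ, hδ, hball⟩ := ht₀
  refine ⟨Real.exp t₀, Real.exp (t₀ + δ / 2), n, Real.exp_pos _,
    Real.exp_lt_exp.2 (by linarith), fun y hy => ?_⟩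
  have hy0 : 0 < y := (Real.exp_pos _).trans_le hy.1
  have h1 : t₀ ≤ Real.log y := (Real.le_log_iff_exp_le hy0).2 hy.1
  have h2 : Real.log y ≤ t₀ + δ / 2 := (Real.log_le_iff_le_exp hy0).2 hy.2
  have h3 : Real.log y ∈ Metric.ball t₀ δ := by
    rw [Metric.mem_ball, Real.dist_eq, abs_lt]
    constructor <;> linarith
  have h4 := hball h3
  simpa only [hF, mem_ofPred_eq, Real.exp_log hy0] using h4

/-- If the Hankel transform of `f` converges absolutely at every point, then `f` is integrable
against the weight `min(1,x)^(Re ν+1/2)`. -/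
theorem integrableOn_weight_of_hankel {ν : ℂ} (hν : -1 < ν.re) {f : ℝ → ℂ}
    (hf : ∀ y : ℝ, 0 < y → IntegrableOn (fun x : ℝ => rootBessel ν (x * y) * f x) (Ioi 0)) :
    IntegrableOn (fun x : ℝ => (min 1 x) ^ (ν.re + 1 / 2) * ‖f x‖) (Ioi 0) := by
  have hfm := aestronglyMeasurable_of_hankel hν hf
  obtain ⟨a, b, N, ha, hab, hN⟩ := exists_lintegral_rootBessel_le hν hf
  obtain ⟨c, hc, hlow⟩ := exists_le_integral_rootBessel hν ha hab
  set s := ν.re + 1 / 2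
  have hwm : Measurable fun x : ℝ => (min 1 x) ^ s := by fun_prop
  refine ⟨hwm.aestronglyMeasurable.mul hfm.norm, ?_⟩
  have hfin : ∫⁻ y in Icc a b, ∫⁻ x in Ioi (0 : ℝ), ‖rootBessel ν (x * y) * f x‖ₑ < ⊤ := by
    calc _ ≤ ∫⁻ y in Icc a b, (N : ENNReal) := setLIntegral_mono' measurableSet_Icc hN
      _ < ⊤ := by
        rw [setLIntegral_const, Real.volume_Icc]
        exact ENNReal.mul_lt_top (by simp) (by simp)
  have hjoint : AEMeasurable (Function.uncurry fun y x => ‖rootBessel ν (x * y) * f x‖ₑ)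
      ((volume.restrict (Icc a b)).prod (volume.restrict (Ioi (0 : ℝ)))) := by
    refine AEStronglyMeasurable.enorm (AEStronglyMeasurable.mul ?_ hfm.comp_snd)
    exact ((measurable_rootBessel hν).comp
      (by fun_prop : Measurable fun p : ℝ × ℝ => p.2 * p.1)).aestronglyMeasurable
  rw [lintegral_lintegral_swap hjoint] at hfin
  have hle : ∫⁻ x in Ioi (0 : ℝ), ENNReal.ofReal c * ‖(min 1 x) ^ s * ‖f x‖‖ₑ ≤
      ∫⁻ x in Ioi (0 : ℝ), ∫⁻ y in Icc a b, ‖rootBessel ν (x * y) * f x‖ₑ := by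
    refine setLIntegral_mono' measurableSet_Ioi fun x hx => ?_
    have hx0 : 0 < x := hx
    have hint : IntegrableOn (fun y => ‖rootBessel ν (x * y)‖) (Icc a b) :=
      (continuousOn_rootBessel_mul hν hx0 ha).norm.integrableOn_Icc
    simp_rw [enorm_mul]
    rw [lintegral_mul_const' _ _ enorm_ne_top, enorm_norm, ← mul_assoc]
    refine mul_le_mul_left ?_ _
    rw [Real.enorm_of_nonneg (by positivity), ← ENNReal.ofReal_mul hc.le]
    refine (ENNReal.ofReal_le_ofReal (hlow x hx0)).trans ?_
    rw [intervalIntegral.integral_of_le hab.le, ← integral_Icc_eq_integral_Ioc,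
      ofReal_integral_eq_lintegral_ofReal hint (.of_forall fun _ => norm_nonneg _)]
    simp only [ofReal_norm, le_refl]
  have h := hle.trans_lt hfin
  rw [lintegral_const_mul' _ _ ENNReal.ofReal_ne_top] at h
  exact ENNReal.lt_top_of_mul_ne_top_right h.ne (by simpa using hc)

/-! ### Weber's integral -/

theorem cpow_two_mul_sub_one {y : ℝ} (hy : 0 < y) (s : ℂ) :
    (y : ℂ) ^ (2 * s - 1) = y * ((y ^ 2 : ℝ) : ℂ) ^ (s - 1) := by
  have hyc : (y : ℂ) ≠ 0 := by exact_mod_cast hy.ne'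
  rw [pow_two, Complex.ofReal_mul, Complex.mul_cpow_ofReal_nonneg hy.le hy.le,
    show 2 * s - 1 = 1 + (s - 1) + (s - 1) by ring, Complex.cpow_add _ _ hyc,
    Complex.cpow_add _ _ hyc, Complex.cpow_one]
  ring

theorem integral_cpow_mul_exp_neg_mul_sq {s : ℂ} (hs : 0 < s.re) {p : ℝ} (hp : 0 < p) :
    ∫ y in Ioi (0 : ℝ), (y : ℂ) ^ (2 * s - 1) * (Real.exp (-p * y ^ 2) : ℂ) =
      1 / 2 * ((p : ℂ) ^ (-s) * Complex.Gamma s) := by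
  have h1 := integral_comp_rpow_Ioi_of_pos (p := 2)
    (g := fun t : ℝ => (t : ℂ) ^ (s - 1) * Complex.exp (-(p * t))) two_pos
  rw [Complex.integral_cpow_mul_exp_neg_mul_Ioi hs hp, one_div, Complex.inv_cpow _ _
    (by rw [Complex.arg_ofReal_of_nonneg hp.le]; exact Real.pi_pos.ne),
    ← Complex.cpow_neg] at h1
  rw [← h1, ← integral_const_mul]
  refine setIntegral_congr_fun measurableSet_Ioi fun y hy => ?_
  have e1 : y ^ ((2 : ℝ) - 1) = y := by norm_num
  have e2 : y ^ (2 : ℝ) = y ^ 2 := Real.rpow_two y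
  simp only [e1, e2]
  rw [cpow_two_mul_sub_one hy, Complex.real_smul]
  push_cast
  ring_nf

theorem norm_cpow_mul_exp_neg_mul_sq {s : ℂ} {p y : ℝ} (hy : 0 < y) :
    ‖(y : ℂ) ^ (2 * s - 1) * (Real.exp (-p * y ^ 2) : ℂ)‖ =
      y ^ (2 * s.re - 1) * Real.exp (-p * y ^ 2) := by
  rw [norm_mul, Complex.norm_cpow_eq_rpow_re_of_pos hy, Complex.norm_real, Real.norm_eq_abs,
    Real.abs_exp]
  simp

theorem integrableOn_cpow_mul_exp_neg_mul_sq {s : ℂ} (hs : 0 < s.re) {p : ℝ} (hp : 0 < p) :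
    IntegrableOn (fun y : ℝ => (y : ℂ) ^ (2 * s - 1) * (Real.exp (-p * y ^ 2) : ℂ)) (Ioi 0) := by
  refine Integrable.mono' (integrableOn_rpow_mul_exp_neg_mul_sq hp (s := 2 * s.re - 1)
    (by linarith)) ?_ ?_
  · have h2 : Measurable fun t : ℝ => (t : ℂ) ^ (2 * s - 1) :=
      Complex.measurable_ofReal.pow_const _
    exact (h2.mul (by fun_prop)).aestronglyMeasurable
  · filter_upwards [ae_restrict_mem measurableSet_Ioi] with y hy
    exact (norm_cpow_mul_exp_neg_mul_sq hy).le

theorem integral_norm_cpow_mul_exp_neg_mul_sq {s : ℂ} (hs : 0 < s.re) {p : ℝ} (hp : 0 < p) :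
    ∫ y in Ioi (0 : ℝ), ‖(y : ℂ) ^ (2 * s - 1) * (Real.exp (-p * y ^ 2) : ℂ)‖ =
      1 / 2 * (p ^ (-s.re) * Real.Gamma s.re) := by
  have h := integral_rpow_mul_exp_neg_mul_rpow (p := 2) (q := 2 * s.re - 1) two_pos
    (by linarith) hp
  rw [show -(2 * s.re - 1 + 1) / 2 = -s.re by ring,
    show (2 * s.re - 1 + 1) / 2 = s.re by ring] at h
  rw [show 1 / 2 * (p ^ (-s.re) * Real.Gamma s.re) =
    p ^ (-s.re) * (1 / 2) * Real.Gamma s.re by ring, ← h]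
  refine setIntegral_congr_fun measurableSet_Ioi fun y hy => ?_
  simp only [norm_cpow_mul_exp_neg_mul_sq hy, Real.rpow_two]

theorem cpow_mul_rootBessel {ν : ℂ} {x y : ℝ} (hx : 0 < x) (hy : 0 < y) :
    (y : ℂ) ^ (ν + 1 / 2) * rootBessel ν (x * y) = (2 : ℂ) ^ (-ν) * (x : ℂ) ^ (ν + 1 / 2) *
      ((y : ℂ) ^ (2 * (ν + 1) - 1) * besselClifford ν (((x * y) ^ 2 / 4 : ℝ) : ℂ)) := by
  have hyc : (y : ℂ) ≠ 0 := by exact_mod_cast hy.ne'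
  have h : (y : ℂ) ^ (2 * (ν + 1) - 1) = (y : ℂ) ^ (ν + 1 / 2) * (y : ℂ) ^ (ν + 1 / 2) := by
    rw [← Complex.cpow_add _ _ hyc]
    ring_nf
  rw [h, rootBessel, Complex.ofReal_mul, Complex.mul_cpow_ofReal_nonneg hx.le hy.le]
  ring

/-- Weber's integral, by termwise integration of the power series. -/
theorem integral_rootBessel_mul_exp_neg_mul_sq {ν : ℂ} (hν : -1 < ν.re) {x p : ℝ} (hx : 0 < x)
    (hp : 0 < p) :
    ∫ y in Ioi (0 : ℝ), (y : ℂ) ^ (ν + 1 / 2) * rootBessel ν (x * y) *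
        (Real.exp (-p * y ^ 2) : ℂ) =
      (2 : ℂ) ^ (-ν) / 2 * (x : ℂ) ^ (ν + 1 / 2) *
        ((p : ℂ) ^ (-ν - 1) * (Real.exp (-(x ^ 2 / (4 * p))) : ℂ)) := by
  have hpc : (p : ℂ) ≠ 0 := by exact_mod_cast hp.ne'
  have hre : ∀ k : ℕ, 0 < (ν + k + 1).re := by
    intro k
    have hk : (0 : ℝ) ≤ k := Nat.cast_nonneg k
    simp
    linarith
  set a : ℕ → ℂ := fun k => (-1 : ℂ) ^ k * ((x ^ 2 / 4 : ℝ) : ℂ) ^ k /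
    ((Nat.factorial k : ℂ) * Complex.Gamma (ν + k + 1)) with ha
  set G : ℕ → ℝ → ℂ := fun k y => a k *
    ((y : ℂ) ^ (2 * (ν + k + 1) - 1) * (Real.exp (-p * y ^ 2) : ℂ)) with hG
  have hGint : ∀ k, Integrable (G k) (volume.restrict (Ioi 0)) := fun k =>
    (integrableOn_cpow_mul_exp_neg_mul_sq (hre k) hp).const_mul _
  have hsum : Summable fun k => ∫ y in Ioi (0 : ℝ), ‖G k y‖ := by
    have hG0 : 0 < ‖Complex.Gamma (ν + 1)‖ := by
      simpa using Gamma_add_nat_add_one_ne_zero hν 0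
    refine Summable.of_nonneg_of_le (fun k => by positivity) (fun k => ?_)
      (summable_besselClifford_bound
        (1 / 2 * p ^ (-(ν.re + 1)) * (Real.Gamma (ν.re + 1) / ‖Complex.Gamma (ν + 1)‖))
        (x ^ 2 / 4 / p))
    simp only [hG, norm_mul (a _)]
    rw [integral_const_mul, integral_norm_cpow_mul_exp_neg_mul_sq (hre k) hp]
    have hGk : 0 < ‖Complex.Gamma (ν + k + 1)‖ :=
      norm_pos_iff.2 (Gamma_add_nat_add_one_ne_zero hν k)
    have h1 : ‖a k‖ = (x ^ 2 / 4) ^ k / (Nat.factorial k * ‖Complex.Gamma (ν + k + 1)‖) := by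
      rw [ha, norm_div, norm_mul, norm_mul, norm_pow, norm_pow, norm_neg, norm_one, one_pow,
        one_mul, Complex.norm_natCast, Complex.norm_real, Real.norm_of_nonneg (by positivity)]
    have h2 : (ν + k + 1).re = ν.re + k + 1 := by simp
    have h3 : Real.Gamma (ν.re + k + 1) ≤
        Real.Gamma (ν.re + 1) / ‖Complex.Gamma (ν + 1)‖ * ‖Complex.Gamma (ν + k + 1)‖ := by
      rw [div_mul_eq_mul_div, le_div_iff₀ hG0, mul_comm]
      exact Gamma_re_add_nat_le hν k
    have h4 : p ^ (-(ν.re + k + 1)) = p ^ (-(ν.re + 1)) / p ^ k := by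
      rw [show -(ν.re + k + 1) = -(ν.re + 1) - k by ring, Real.rpow_sub hp, Real.rpow_natCast]
    rw [h1, h2, h4]
    calc _ ≤ (x ^ 2 / 4) ^ k / (Nat.factorial k * ‖Complex.Gamma (ν + k + 1)‖) *
          (1 / 2 * (p ^ (-(ν.re + 1)) / p ^ k * (Real.Gamma (ν.re + 1) /
            ‖Complex.Gamma (ν + 1)‖ * ‖Complex.Gamma (ν + k + 1)‖))) := by gcongr
      _ = _ := by
        rw [div_pow (x ^ 2 / 4) p]
        field_simp
  have key := integral_tsum_of_summable_integral_norm hGint hsum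
  have hL : ∀ k, ∫ y in Ioi (0 : ℝ), G k y =
      1 / 2 * (p : ℂ) ^ (-ν - 1) * ((((-(x ^ 2 / (4 * p)) : ℝ) : ℂ)) ^ k / Nat.factorial k) := by
    intro k
    simp only [hG]
    rw [integral_const_mul, integral_cpow_mul_exp_neg_mul_sq (hre k) hp, ha,
      show -(ν + k + 1) = (-ν - 1) - k by ring, Complex.cpow_sub _ _ hpc, Complex.cpow_natCast]
    have hGk := Gamma_add_nat_add_one_ne_zero hν k
    have hf : (Nat.factorial k : ℂ) ≠ 0 := by exact_mod_cast Nat.factorial_ne_zero k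
    have : (((-(x ^ 2 / (4 * p)) : ℝ) : ℂ)) ^ k =
        (-1) ^ k * ((x ^ 2 / 4 : ℝ) : ℂ) ^ k / (p : ℂ) ^ k := by
      rw [← mul_pow, ← div_pow]
      congr 1
      push_cast
      field_simp
    rw [this]
    field_simp
  simp_rw [hL] at key
  rw [tsum_mul_left] at key
  have hexp : ∑' k : ℕ, (((-(x ^ 2 / (4 * p)) : ℝ) : ℂ)) ^ k / Nat.factorial k =
      (Real.exp (-(x ^ 2 / (4 * p))) : ℂ) := by
    rw [Complex.ofReal_exp, Complex.exp_eq_exp_ℂ, NormedSpace.exp_eq_tsum_div]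
  rw [hexp] at key
  calc _ = ∫ y in Ioi (0 : ℝ), (2 : ℂ) ^ (-ν) * (x : ℂ) ^ (ν + 1 / 2) * ∑' k, G k y := by
        refine setIntegral_congr_fun measurableSet_Ioi fun y hy => ?_
        have hy0 : 0 < y := hy
        have hyc : (y : ℂ) ≠ 0 := by exact_mod_cast hy0.ne'
        rw [cpow_mul_rootBessel hx hy0, besselClifford, mul_assoc _ (_ * _) (_ : ℂ), ← tsum_mul_left,
          ← tsum_mul_right]
        congr 1
        refine tsum_congr fun k => ?_
        simp only [hG, ha]
        rw [show 2 * (ν + k + 1) - 1 = (2 * (ν + 1) - 1) + (2 * k : ℕ) by push_cast; ring,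
          Complex.cpow_add _ _ hyc, Complex.cpow_natCast, pow_mul]
        have : (((x * y) ^ 2 / 4 : ℝ) : ℂ) ^ k =
            ((x ^ 2 / 4 : ℝ) : ℂ) ^ k * ((y : ℂ) ^ 2) ^ k := by
          rw [← mul_pow]
          congr 1
          push_cast
          ring
        rw [this]
        ring
    _ = _ := by
        rw [integral_const_mul, ← key]
        ring

/-! ### The regularized kernel -/

/-- The factor `r^(-ν-1) exp(-x²/(4r))` of Weber's integral, and of the integral
`∫ exp(-u²r) r^(-ν-1) exp(-x²/(4r)) dr` for the Macdonald function. -/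
noncomputable def heatFactor (ν : ℂ) (x r : ℝ) : ℂ :=
  (r : ℂ) ^ (-ν - 1) * (Real.exp (-(x ^ 2 / (4 * r))) : ℂ)

/-- The integral `∫_0^∞ exp(-u²s) (s+ε)^(-ν-1) exp(-x²/(4(s+ε))) ds`: up to a factor, the value of
`∫_0^∞ y^(ν+1) J_ν(xy) exp(-εy²)/(u²+y²) dy` for `ε > 0`, and `K_ν(xu)` for `ε = 0`. -/
noncomputable def regMacdonald (ν : ℂ) (x u ε : ℝ) : ℂ :=
  ∫ s in Ioi (0 : ℝ), (Real.exp (-(u ^ 2 * s)) : ℂ) * heatFactor ν x (s + ε)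

theorem norm_heatFactor (ν : ℂ) (x : ℝ) {r : ℝ} (hr : 0 < r) :
    ‖heatFactor ν x r‖ = r ^ (-ν.re - 1) * Real.exp (-(x ^ 2 / (4 * r))) := by
  rw [heatFactor, norm_mul, Complex.norm_cpow_eq_rpow_re_of_pos hr, Complex.norm_real,
    Real.norm_eq_abs, Real.abs_exp]
  simp

theorem rpow_le_rpow_mul_exp {q a : ℝ} (hq : 0 < q) (ha : 0 ≤ a) :
    a ^ q ≤ q ^ q * Real.exp a := by
  have h1 : a ≤ q * Real.exp (a / q) := by
    have := Real.add_one_le_exp (a / q)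
    have h2 : a / q ≤ Real.exp (a / q) := by linarith
    rwa [div_le_iff₀' hq] at h2
  calc a ^ q ≤ (q * Real.exp (a / q)) ^ q := Real.rpow_le_rpow ha h1 hq.le
    _ = q ^ q * Real.exp a := by
      rw [Real.mul_rpow hq.le (Real.exp_pos _).le, ← Real.exp_mul, div_mul_cancel₀ _ hq.ne']

theorem norm_heatFactor_le {ν : ℂ} (hν : -1 < ν.re) {x r : ℝ} (hx : 0 < x) (hr : 0 < r) :
    ‖heatFactor ν x r‖ ≤ (4 * (ν.re + 1)) ^ (ν.re + 1) * x ^ (-2 * (ν.re + 1)) := by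
  have hq : 0 < ν.re + 1 := by linarith
  set q := ν.re + 1 with hqd
  rw [norm_heatFactor ν x hr, show -ν.re - 1 = -q by rw [hqd]; ring]
  have h := rpow_le_rpow_mul_exp hq (a := x ^ 2 / (4 * r)) (by positivity)
  rw [Real.div_rpow (by positivity) (by positivity), Real.mul_rpow (by norm_num) hr.le,
    div_le_iff₀ (by positivity)] at h
  rw [Real.exp_neg, Real.rpow_neg hr.le, Real.mul_rpow (by norm_num) hq.le,
    show -2 * q = -(2 * q) by ring, Real.rpow_neg hx.le, Real.rpow_mul hx.le, Real.rpow_two,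
    ← mul_inv, ← div_eq_mul_inv, inv_eq_one_div, div_le_div_iff₀ (by positivity) (by positivity)]
  linarith

theorem measurable_heatFactor (ν : ℂ) (x : ℝ) : Measurable (heatFactor ν x) := by
  have h2 : Measurable fun t : ℝ => (t : ℂ) ^ (-ν - 1) :=
    Complex.measurable_ofReal.pow_const _
  exact h2.mul (by fun_prop)

theorem continuousAt_heatFactor (ν : ℂ) (x : ℝ) {r : ℝ} (hr : 0 < r) :
    ContinuousAt (heatFactor ν x) r := by
  refine ContinuousAt.mul
    (Complex.continuousAt_ofReal_cpow_const r _ (Or.inr hr.ne')) ?_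
  refine Complex.continuous_ofReal.continuousAt.comp (Real.continuous_exp.continuousAt.comp ?_)
  exact (continuousAt_const.div (by fun_prop) (by positivity)).neg

theorem integrableOn_exp_neg_sq_mul {u : ℝ} (hu : 0 < u) :
    IntegrableOn (fun s : ℝ => Real.exp (-(u ^ 2 * s))) (Ioi 0) := by
  simpa [neg_mul] using integrableOn_exp_mul_Ioi (a := -(u ^ 2)) (neg_lt_zero.2 (by positivity)) 0

theorem integral_exp_neg_mul_eq {a : ℝ} (ha : 0 < a) :
    ∫ s in Ioi (0 : ℝ), Real.exp (-(a * s)) = 1 / a := by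
  have := integral_exp_mul_Ioi (a := -a) (by linarith) 0
  simpa [neg_mul] using this

theorem measurable_regMacdonald_integrand (ν : ℂ) (x u ε : ℝ) :
    Measurable fun s : ℝ => (Real.exp (-(u ^ 2 * s)) : ℂ) * heatFactor ν x (s + ε) :=
  Measurable.mul (by fun_prop) ((measurable_heatFactor ν x).comp (by fun_prop))

theorem norm_regMacdonald_integrand_le {ν : ℂ} (hν : -1 < ν.re) {x ε s : ℝ} (u : ℝ) (hx : 0 < x)
    (hε : 0 ≤ ε) (hs : 0 < s) :
    ‖(Real.exp (-(u ^ 2 * s)) : ℂ) * heatFactor ν x (s + ε)‖ ≤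
      (4 * (ν.re + 1)) ^ (ν.re + 1) * x ^ (-2 * (ν.re + 1)) * Real.exp (-(u ^ 2 * s)) := by
  rw [norm_mul, Complex.norm_real, Real.norm_eq_abs, Real.abs_exp, mul_comm]
  gcongr
  exact norm_heatFactor_le hν hx (by linarith)

theorem integrableOn_regMacdonald_integrand {ν : ℂ} (hν : -1 < ν.re) {x u ε : ℝ} (hx : 0 < x)
    (hu : 0 < u) (hε : 0 ≤ ε) :
    IntegrableOn (fun s : ℝ => (Real.exp (-(u ^ 2 * s)) : ℂ) * heatFactor ν x (s + ε)) (Ioi 0) := by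
  refine Integrable.mono' ((integrableOn_exp_neg_sq_mul hu).const_mul
    ((4 * (ν.re + 1)) ^ (ν.re + 1) * x ^ (-2 * (ν.re + 1))))
    (measurable_regMacdonald_integrand ν x u ε).aestronglyMeasurable ?_
  filter_upwards [ae_restrict_mem measurableSet_Ioi] with s hs
  exact norm_regMacdonald_integrand_le hν u hx hε hs

theorem norm_regMacdonald_le {ν : ℂ} (hν : -1 < ν.re) {x u ε : ℝ} (hx : 0 < x)
    (hu : 0 < u) (hε : 0 ≤ ε) :
    ‖regMacdonald ν x u ε‖ ≤
      (4 * (ν.re + 1)) ^ (ν.re + 1) * x ^ (-2 * (ν.re + 1)) * (1 / u ^ 2) := by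
  rw [← integral_exp_neg_mul_eq (a := u ^ 2) (by positivity), ← integral_const_mul]
  refine norm_integral_le_of_norm_le ((integrableOn_exp_neg_sq_mul hu).const_mul _) ?_
  filter_upwards [ae_restrict_mem measurableSet_Ioi] with s hs
  exact norm_regMacdonald_integrand_le hν u hx hε hs

theorem tendsto_regMacdonald_zero {ν : ℂ} (hν : -1 < ν.re) {x u : ℝ} (hx : 0 < x) (hu : 0 < u) :
    Tendsto (regMacdonald ν x u) (𝓝[>] 0) (𝓝 (regMacdonald ν x u 0)) := by
  refine tendsto_integral_filter_of_dominated_convergence _ (.of_forall fun ε =>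
    (measurable_regMacdonald_integrand ν x u ε).aestronglyMeasurable) ?_
    ((integrableOn_exp_neg_sq_mul hu).const_mul
    ((4 * (ν.re + 1)) ^ (ν.re + 1) * x ^ (-2 * (ν.re + 1)))) ?_
  · filter_upwards [self_mem_nhdsWithin] with ε hε
    filter_upwards [ae_restrict_mem measurableSet_Ioi] with s hs
    exact norm_regMacdonald_integrand_le hν u hx (le_of_lt hε) hs
  · filter_upwards [ae_restrict_mem measurableSet_Ioi] with s hs
    refine Tendsto.const_mul _ ?_
    have hs0 : 0 < s := hs
    have hc := (continuousAt_heatFactor ν x (r := s + 0) (by linarith)).tendsto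
    refine hc.comp (Tendsto.mono_left ?_ nhdsWithin_le_nhds)
    exact Continuous.tendsto (by fun_prop) 0

theorem tendsto_regMacdonald_atTop {ν : ℂ} (hν : -1 < ν.re) {x u : ℝ} (hx : 0 < x) (hu : 0 < u) :
    Tendsto (regMacdonald ν x u) atTop (𝓝 0) := by
  rw [show (0 : ℂ) = ∫ s in Ioi (0 : ℝ), (0 : ℂ) by simp]
  refine tendsto_integral_filter_of_dominated_convergence _ (.of_forall fun ε =>
    (measurable_regMacdonald_integrand ν x u ε).aestronglyMeasurable) ?_
    ((integrableOn_exp_neg_sq_mul hu).const_mul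
    ((4 * (ν.re + 1)) ^ (ν.re + 1) * x ^ (-2 * (ν.re + 1)))) ?_
  · filter_upwards [eventually_ge_atTop 0] with ε hε
    filter_upwards [ae_restrict_mem measurableSet_Ioi] with s hs
    exact norm_regMacdonald_integrand_le hν u hx hε hs
  · filter_upwards [ae_restrict_mem measurableSet_Ioi] with s hs
    have hs0 : 0 < s := hs
    rw [← mul_zero (Real.exp (-(u ^ 2 * s)) : ℂ)]
    refine Tendsto.const_mul _ ?_
    have h1 : Tendsto (fun ε : ℝ => (s + ε) ^ (-ν.re - 1)) atTop (𝓝 0) := by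
      have := (tendsto_rpow_neg_atTop (y := ν.re + 1) (by linarith)).comp
        (tendsto_atTop_add_const_left atTop s tendsto_id)
      refine this.congr fun ε => ?_
      simp
      ring_nf
    refine squeeze_zero_norm' ?_ h1
    filter_upwards [eventually_ge_atTop 0] with ε hε
    have : 0 < s + ε := by linarith
    rw [norm_heatFactor ν x this]
    exact mul_le_of_le_one_right (by positivity)
      (Real.exp_le_one_iff.2 (by simp; positivity))

theorem integrableOn_cpow_mul_rootBessel {ν : ℂ} (hν : -1 < ν.re) {x ε : ℝ} (hx : 0 < x)
    (hε : 0 < ε) :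
    IntegrableOn (fun y : ℝ => (y : ℂ) ^ (ν + 1 / 2) * rootBessel ν (x * y) *
      (Real.exp (-ε * y ^ 2) : ℂ)) (Ioi 0) := by
  obtain ⟨C, hC, hb⟩ := exists_norm_rootBessel_mul_le hν
  set σ := ν.re + 1 / 2 with hσ
  have hσ1 : -1 < 2 * σ := by rw [hσ]; linarith
  refine Integrable.mono' (((integrableOn_rpow_mul_exp_neg_mul_sq hε (s := σ) (by linarith)).add
    (integrableOn_rpow_mul_exp_neg_mul_sq hε hσ1)).const_mul (C * (min 1 x) ^ σ)) ?_ ?_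
  · have h2 : Measurable fun t : ℝ => (t : ℂ) ^ (ν + 1 / 2) :=
      Complex.measurable_ofReal.pow_const _
    exact ((h2.mul ((measurable_rootBessel hν).comp (by fun_prop))).mul
      (by fun_prop)).aestronglyMeasurable
  · filter_upwards [ae_restrict_mem measurableSet_Ioi] with y hy
    have hy0 : 0 < y := hy
    rw [norm_mul, norm_mul, Complex.norm_cpow_eq_rpow_re_of_pos hy0, Complex.norm_real,
      Real.norm_eq_abs, Real.abs_exp, show (ν + 1 / 2).re = σ by simp [hσ]]
    have hyσ : 0 ≤ y ^ σ := by positivity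
    calc _ ≤ y ^ σ * (C * ((min 1 x) ^ σ * (1 + y ^ σ))) * Real.exp (-ε * y ^ 2) := by
          gcongr
          exact hb x y hx hy0
      _ = _ := by
        simp only [Pi.add_apply]
        have h2 : y ^ (2 * σ) = y ^ σ * y ^ σ := by rw [two_mul, Real.rpow_add hy0]
        rw [h2]
        generalize y ^ σ = z
        ring

/-- The Gaussian regularization of `∫ y^(ν+1) J_ν(xy)/(u²+y²) dy`: write `1/(u²+y²)` as a Laplace
integral and apply Weber's integral. -/
theorem integral_rootBessel_mul_exp_div {ν : ℂ} (hν : -1 < ν.re) {x u ε : ℝ} (hx : 0 < x)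
    (hu : 0 < u) (hε : 0 < ε) :
    ∫ y in Ioi (0 : ℝ), (y : ℂ) ^ (ν + 1 / 2) * rootBessel ν (x * y) *
        (Real.exp (-ε * y ^ 2) : ℂ) * ((1 / (u ^ 2 + y ^ 2) : ℝ) : ℂ) =
      (2 : ℂ) ^ (-ν) / 2 * (x : ℂ) ^ (ν + 1 / 2) * regMacdonald ν x u ε := by
  set h : ℝ → ℂ := fun y => (y : ℂ) ^ (ν + 1 / 2) * rootBessel ν (x * y) *
    (Real.exp (-ε * y ^ 2) : ℂ) with hh
  have hint : IntegrableOn h (Ioi 0) := integrableOn_cpow_mul_rootBessel hν hx hε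
  have hprod : Integrable (Function.uncurry fun (y s : ℝ) =>
      h y * (Real.exp (-((u ^ 2 + y ^ 2) * s)) : ℂ))
      ((volume.restrict (Ioi 0)).prod (volume.restrict (Ioi 0))) := by
    have h0 : IntegrableOn (fun s : ℝ => (Real.exp (-(u ^ 2 * s)) : ℂ)) (Ioi 0) :=
      (integrableOn_exp_neg_sq_mul hu).ofReal
    have h1 := Integrable.mul_prod hint h0
    have h2 : Integrable (fun z : ℝ × ℝ => (Real.exp (-(z.1 ^ 2 * z.2)) : ℂ) *
        (h z.1 * (Real.exp (-(u ^ 2 * z.2)) : ℂ)))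
        ((volume.restrict (Ioi 0)).prod (volume.restrict (Ioi 0))) := by
      refine h1.bdd_mul (c := 1) (by fun_prop) ?_
      rw [Measure.prod_restrict]
      filter_upwards [ae_restrict_mem (measurableSet_Ioi.prod measurableSet_Ioi)] with z hz
      have hz2 : 0 < z.2 := hz.2
      rw [Complex.norm_real, Real.norm_eq_abs, Real.abs_exp, Real.exp_le_one_iff]
      have : 0 ≤ z.1 ^ 2 * z.2 := by positivity
      linarith
    refine h2.congr (.of_forall fun z => ?_)
    simp only [Function.uncurry]
    rw [add_mul, neg_add, Real.exp_add]
    push_cast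
    ring
  calc _ = ∫ y in Ioi (0 : ℝ), ∫ s in Ioi (0 : ℝ),
        h y * (Real.exp (-((u ^ 2 + y ^ 2) * s)) : ℂ) := by
        refine setIntegral_congr_fun measurableSet_Ioi fun y hy => ?_
        rw [integral_const_mul, integral_complex_ofReal,
          integral_exp_neg_mul_eq (by positivity)]
    _ = ∫ s in Ioi (0 : ℝ), ∫ y in Ioi (0 : ℝ),
        h y * (Real.exp (-((u ^ 2 + y ^ 2) * s)) : ℂ) := integral_integral_swap hprod
    _ = _ := by
        rw [regMacdonald, ← integral_const_mul]
        refine setIntegral_congr_fun measurableSet_Ioi fun s hs => ?_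
        have hs0 : 0 < s := hs
        have hw := integral_rootBessel_mul_exp_neg_mul_sq hν hx (p := s + ε) (by linarith)
        rw [heatFactor, mul_left_comm, ← hw, ← integral_const_mul]
        refine integral_congr_ae (.of_forall fun y => ?_)
        simp only [hh]
        rw [show -((u ^ 2 + y ^ 2) * s) = -(u ^ 2 * s) + -s * y ^ 2 by ring,
          show -(s + ε) * y ^ 2 = -s * y ^ 2 + -ε * y ^ 2 by ring, Real.exp_add, Real.exp_add]
        push_cast
        ring

/-! ### The Macdonald function -/

theorem besselK_neg (ν : ℂ) (z : ℝ) : besselK (-ν) z = besselK ν z := by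
  simp only [besselK, neg_mul, Complex.cosh_neg]

theorem image_const_mul_exp_univ {c : ℝ} (hc : 0 < c) :
    (fun t => c * Real.exp t) '' univ = Ioi 0 := by
  ext s
  simp only [image_univ, mem_range, mem_Ioi]
  constructor
  · rintro ⟨t, rfl⟩
    positivity
  · intro hs
    exact ⟨Real.log (s / c), by rw [Real.exp_log (by positivity)]; field_simp⟩

theorem cpow_ofReal_exp (t : ℝ) (ν : ℂ) : ((Real.exp t : ℝ) : ℂ) ^ ν = Complex.exp (ν * t) := by
  rw [Complex.cpow_def_of_ne_zero (by exact_mod_cast (Real.exp_pos t).ne'),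
    ← Complex.ofReal_log (Real.exp_pos t).le, Real.log_exp, mul_comm]

/-- The substitution `s = x/(2u) e^t` turns the integral at `ε = 0` into the Macdonald function. -/
theorem regMacdonald_zero_eq {ν : ℂ} {x u : ℝ} (hx : 0 < x) (hu : 0 < u)
    (hint : IntegrableOn (fun s : ℝ => (Real.exp (-(u ^ 2 * s)) : ℂ) * heatFactor ν x (s + 0))
      (Ioi 0)) :
    regMacdonald ν x u 0 = 2 * ((2 * u / x : ℝ) : ℂ) ^ ν * besselK ν (x * u) := by
  set c := x / (2 * u) with hc
  have hc0 : 0 < c := by positivity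
  set φ : ℝ → ℂ := fun t => ((2 * u / x : ℝ) : ℂ) ^ ν *
    ((Real.exp (-(x * u) * Real.cosh t) : ℂ) * Complex.exp (-ν * t)) with hφ
  have hderiv : ∀ t ∈ (univ : Set ℝ), HasDerivWithinAt (fun t => c * Real.exp t)
      (c * Real.exp t) univ t := fun t _ => ((Real.hasDerivAt_exp t).const_mul c).hasDerivWithinAt
  have hinj : InjOn (fun t => c * Real.exp t) univ := fun a _ b _ h =>
    Real.exp_injective (mul_left_cancel₀ hc0.ne' h)
  have hpt : ∀ t : ℝ, |c * Real.exp t| • ((Real.exp (-(u ^ 2 * (c * Real.exp t))) : ℂ) *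
      heatFactor ν x (c * Real.exp t + 0)) = φ t := by
    intro t
    have he : 0 < c * Real.exp t := by positivity
    have hec : ((c * Real.exp t : ℝ) : ℂ) ≠ 0 := by exact_mod_cast he.ne'
    have h1 : ((c * Real.exp t : ℝ) : ℂ) ^ (-ν - 1) =
        ((2 * u / x : ℝ) : ℂ) ^ ν * Complex.exp (-ν * t) / ((c * Real.exp t : ℝ) : ℂ) := by
      rw [Complex.cpow_sub _ _ hec, Complex.cpow_one, Complex.ofReal_mul,
        Complex.mul_cpow_ofReal_nonneg hc0.le (Real.exp_pos t).le, cpow_ofReal_exp,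
        show 2 * u / x = c⁻¹ by rw [hc, inv_div], Complex.ofReal_inv, Complex.inv_cpow,
        Complex.cpow_neg]
      rw [Complex.arg_ofReal_of_nonneg hc0.le]
      exact Real.pi_pos.ne
    have h2 : Real.exp (-(u ^ 2 * (c * Real.exp t))) *
        Real.exp (-(x ^ 2 / (4 * (c * Real.exp t)))) = Real.exp (-(x * u) * Real.cosh t) := by
      rw [← Real.exp_add, Real.cosh_eq, Real.exp_neg t, hc]
      congr 1
      have := Real.exp_pos t
      field_simp
      ring
    rw [heatFactor, add_zero, h1, abs_of_pos he, Complex.real_smul, hφ]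
    simp only
    rw [← h2, Complex.ofReal_mul (Real.exp _) (Real.exp _)]
    field_simp
  have hφint : Integrable φ := by
    rw [← image_const_mul_exp_univ hc0,
      integrableOn_image_iff_integrableOn_abs_deriv_smul MeasurableSet.univ hderiv hinj] at hint
    rw [← integrableOn_univ]
    exact hint.congr_fun (fun t _ => hpt t) MeasurableSet.univ
  have h1 : regMacdonald ν x u 0 = ∫ t, φ t := by
    rw [regMacdonald, ← image_const_mul_exp_univ hc0,
      integral_image_eq_integral_abs_deriv_smul MeasurableSet.univ hderiv hinj, setIntegral_univ]
    exact integral_congr_ae (.of_forall hpt)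
  have hneg : IntegrableOn (fun t => φ (-t)) (Ioi 0) := hφint.comp_neg.integrableOn
  rw [h1, ← intervalIntegral.integral_Iic_add_Ioi hφint.integrableOn hφint.integrableOn (b := 0),
    ← neg_zero, ← integral_comp_neg_Ioi, neg_zero, ← integral_add hneg hφint.integrableOn, besselK,
    ← integral_const_mul]
  refine setIntegral_congr_fun measurableSet_Ioi fun t _ => ?_
  simp only [hφ, Real.cosh_neg, Complex.cosh]
  push_cast
  ring_nf

/-- Near `0` the Macdonald function is at least of the order `z^(-Re μ)`: the limit of
`regMacdonald (-μ) z 1 0`, a multiple of `z^μ K_μ(z)`, is `Γ(μ) ≠ 0`. -/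
theorem exists_le_norm_besselK {μ : ℂ} (hμ : 0 < μ.re) :
    ∃ c z₀ : ℝ, 0 < c ∧ 0 < z₀ ∧ ∀ z : ℝ, 0 < z → z ≤ z₀ → c ≤ z ^ μ.re * ‖besselK μ z‖ := by
  have hGint : IntegrableOn (fun s : ℝ => Real.exp (-s) * s ^ (μ.re - 1)) (Ioi 0) :=
    Real.GammaIntegral_convergent hμ
  have hbound : ∀ z s : ℝ, 0 < s →
      ‖(Real.exp (-((1 : ℝ) ^ 2 * s)) : ℂ) * heatFactor (-μ) z (s + 0)‖ ≤
        Real.exp (-s) * s ^ (μ.re - 1) := by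
    intro z s hs
    rw [add_zero, norm_mul, norm_heatFactor _ _ hs, Complex.norm_real, Real.norm_eq_abs,
      Real.abs_exp, one_pow, one_mul, Complex.neg_re, neg_neg]
    gcongr
    exact mul_le_of_le_one_right (by positivity) (Real.exp_le_one_iff.2 (by simp; positivity))
  have hlim : Tendsto (fun z => regMacdonald (-μ) z 1 0) (𝓝[>] 0) (𝓝 (Complex.Gamma μ)) := by
    rw [Complex.Gamma_eq_integral hμ, Complex.GammaIntegral]
    refine tendsto_integral_filter_of_dominated_convergence _ (.of_forall fun z =>
      (measurable_regMacdonald_integrand (-μ) z 1 0).aestronglyMeasurable) (.of_forall fun z => ?_)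
      hGint ?_
    · filter_upwards [ae_restrict_mem measurableSet_Ioi] with s hs using hbound z s hs
    · filter_upwards [ae_restrict_mem measurableSet_Ioi] with s hs
      have hs0 : 0 < s := hs
      refine Tendsto.mono_left ?_ nhdsWithin_le_nhds
      have hc : Continuous fun z : ℝ =>
          (Real.exp (-((1 : ℝ) ^ 2 * s)) : ℂ) * heatFactor (-μ) z (s + 0) := by
        unfold heatFactor
        fun_prop
      convert hc.tendsto 0 using 2
      simp [heatFactor]
  have hG : 0 < ‖Complex.Gamma μ‖ := norm_pos_iff.2 (Complex.Gamma_ne_zero_of_re_pos hμ)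
  have hev := hlim.norm.eventually (lt_mem_nhds (half_lt_self hG))
  obtain ⟨z₀, hz₀, hz⟩ := mem_nhdsGT_iff_exists_Ioc_subset.1 hev
  refine ⟨‖Complex.Gamma μ‖ / 2 / (2 * 2 ^ (-μ.re)), z₀, by positivity, hz₀, fun z h0 h1 => ?_⟩
  have h := hz ⟨h0, h1⟩
  have hint : IntegrableOn (fun s : ℝ => (Real.exp (-((1 : ℝ) ^ 2 * s)) : ℂ) *
      heatFactor (-μ) z (s + 0)) (Ioi 0) := by
    refine Integrable.mono' hGint
      (measurable_regMacdonald_integrand (-μ) z 1 0).aestronglyMeasurable ?_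
    filter_upwards [ae_restrict_mem measurableSet_Ioi] with s hs using hbound z s hs
  simp only [mem_ofPred_eq] at h
  rw [regMacdonald_zero_eq h0 one_pos hint, mul_one, besselK_neg, norm_mul, norm_mul,
    Complex.norm_cpow_eq_rpow_re_of_pos (by positivity), Complex.neg_re, mul_one,
    Real.div_rpow (by norm_num) h0.le, Real.rpow_neg h0.le, div_inv_eq_mul] at h
  rw [div_le_iff₀ (by positivity)]
  norm_num at h ⊢
  linarith

/-! ### Uniform bounds for the regularized kernel -/

theorem integrableOn_Ioi_comp_add {g : ℝ → ℝ} (hg : IntegrableOn g (Ioi 0)) {ε : ℝ} (hε : 0 ≤ ε) :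
    IntegrableOn (fun s => g (s + ε)) (Ioi 0) := by
  have h1 := ((integrable_indicator_iff measurableSet_Ioi).2 hg).comp_add_right ε
  refine (h1.integrableOn (s := Ioi 0)).congr_fun (fun s hs => ?_) measurableSet_Ioi
  have hs0 : 0 < s := hs
  exact indicator_of_mem (show s + ε ∈ Ioi (0 : ℝ) from add_pos_of_pos_of_nonneg hs0 hε) g

theorem integral_Ioi_comp_add_le {g : ℝ → ℝ} (hg : IntegrableOn g (Ioi 0))
    (hg0 : ∀ s, 0 < s → 0 ≤ g s) {ε : ℝ} (hε : 0 ≤ ε) :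
    ∫ s in Ioi 0, g (s + ε) ≤ ∫ s in Ioi 0, g s := by
  have h1 := (integrable_indicator_iff measurableSet_Ioi).2 hg
  rw [← integral_indicator measurableSet_Ioi, ← integral_indicator measurableSet_Ioi,
    ← integral_add_right_eq_self (μ := volume) ((Ioi 0).indicator g) ε]
  refine integral_mono ?_ (h1.comp_add_right ε) fun s => ?_
  · exact (integrable_indicator_iff measurableSet_Ioi).2 (integrableOn_Ioi_comp_add hg hε)
  · by_cases hs : 0 < s
    · rw [indicator_of_mem (show s ∈ Ioi (0 : ℝ) from hs),
        indicator_of_mem (show s + ε ∈ Ioi (0 : ℝ) from add_pos_of_pos_of_nonneg hs hε)]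
    · rw [indicator_of_notMem (show s ∉ Ioi (0 : ℝ) from hs)]
      exact indicator_nonneg (fun s hs => hg0 s hs) _

theorem div_rpow_eq_mul_rpow {x u : ℝ} (hx : 0 < x) (hu : 0 < u) (σ : ℝ) :
    x ^ (-2 * σ) = (u / x) ^ σ * (x * u) ^ (-σ) := by
  rw [Real.div_rpow hu.le hx.le, Real.mul_rpow hx.le hu.le, Real.rpow_neg hu.le,
    show -2 * σ = -σ + -σ by ring, Real.rpow_add hx, Real.rpow_neg hx.le]
  have h1 : u ^ σ ≠ 0 := (Real.rpow_pos_of_pos hu σ).ne'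
  have h2 : x ^ σ ≠ 0 := (Real.rpow_pos_of_pos hx σ).ne'
  field_simp

/-- The absolutely convergent majorant in the case `Re ν > 0`. -/
theorem norm_regMacdonald_le_of_re_pos {ν : ℂ} (hν : 0 < ν.re) {x u ε : ℝ} (hx : 0 < x)
    (hε : 0 ≤ ε) :
    ‖regMacdonald ν x u ε‖ ≤ 4 ^ ν.re * Real.Gamma ν.re * x ^ (-2 * ν.re) := by
  set g : ℝ → ℝ := fun r => r ^ (-ν.re - 1) * Real.exp (-(x ^ 2 / (4 * r))) with hg
  have hx4 : 0 < x ^ 2 / 4 := by positivity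
  have hpt : ∀ t ∈ Ioi (0 : ℝ), (|(-1 : ℝ)| * t ^ ((-1 : ℝ) - 1)) • g (t ^ (-1 : ℝ)) =
      t ^ (ν.re - 1) * Real.exp (-(x ^ 2 / 4 * t)) := by
    intro t ht
    have ht0 : 0 < t := ht
    simp only [hg]
    rw [smul_eq_mul, abs_neg, abs_one, one_mul, ← Real.rpow_mul ht0.le, ← mul_assoc,
      ← Real.rpow_add ht0, Real.rpow_neg_one]
    congr 2
    · ring
    · field_simp
  have hint : IntegrableOn g (Ioi 0) := by
    rw [← integrableOn_Ioi_comp_rpow_iff g (p := -1) (by norm_num)]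
    refine IntegrableOn.congr_fun ?_ (fun t ht => (hpt t ht).symm) measurableSet_Ioi
    have := integrableOn_rpow_mul_exp_neg_mul_rpow (p := 1) (s := ν.re - 1) (b := x ^ 2 / 4)
      (by linarith) one_pos hx4
    simpa only [Real.rpow_one, neg_mul] using this
  have hval : ∫ r in Ioi 0, g r = 4 ^ ν.re * Real.Gamma ν.re * x ^ (-2 * ν.re) := by
    rw [← integral_comp_rpow_Ioi g (p := -1) (by norm_num),
      setIntegral_congr_fun measurableSet_Ioi hpt, Real.integral_rpow_mul_exp_neg_mul_Ioi hν hx4,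
      one_div_div, Real.div_rpow (by norm_num) (by positivity), ← Real.rpow_two,
      ← Real.rpow_mul hx.le, neg_mul, Real.rpow_neg hx.le]
    ring
  rw [← hval]
  refine le_trans ?_ (integral_Ioi_comp_add_le hint (fun s hs => by positivity) hε)
  refine norm_integral_le_of_norm_le (integrableOn_Ioi_comp_add hint hε) ?_
  filter_upwards [ae_restrict_mem measurableSet_Ioi] with s hs
  have hs0 : 0 < s := hs
  have hsε : 0 < s + ε := by linarith
  rw [norm_mul, norm_heatFactor _ _ hsε, Complex.norm_real, Real.norm_eq_abs, Real.abs_exp]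
  exact mul_le_of_le_one_left (by positivity) (Real.exp_le_one_iff.2 (by simp; positivity))

/-- The absolutely convergent majorant in the case `-1 < Re ν < 0`. -/
theorem norm_regMacdonald_le_of_re_neg {ν : ℂ} (hν : -1 < ν.re) (hν0 : ν.re < 0) {x u ε : ℝ}
    (hu : 0 < u) (hε : 0 ≤ ε) :
    ‖regMacdonald ν x u ε‖ ≤ Real.Gamma (-ν.re) * u ^ (2 * ν.re) := by
  have hu2 : 0 < u ^ 2 := by positivity
  have hval := Real.integral_rpow_mul_exp_neg_mul_Ioi (a := -ν.re) (by linarith) hu2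
  have hint : IntegrableOn (fun s : ℝ => s ^ (-ν.re - 1) * Real.exp (-(u ^ 2 * s))) (Ioi 0) := by
    have := integrableOn_rpow_mul_exp_neg_mul_rpow (p := 1) (s := -ν.re - 1) (b := u ^ 2)
      (by linarith) one_pos hu2
    simpa only [Real.rpow_one, neg_mul] using this
  have he : (1 / u ^ 2) ^ (-ν.re) = u ^ (2 * ν.re) := by
    rw [one_div, Real.inv_rpow hu2.le, Real.rpow_neg hu2.le, inv_inv, Real.rpow_mul hu.le,
      Real.rpow_two]
  rw [mul_comm, ← he, ← hval]
  refine norm_integral_le_of_norm_le hint ?_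
  filter_upwards [ae_restrict_mem measurableSet_Ioi] with s hs
  have hs0 : 0 < s := hs
  have hsε : 0 < s + ε := by linarith
  rw [norm_mul, norm_heatFactor _ _ hsε, Complex.norm_real, Real.norm_eq_abs, Real.abs_exp, mul_comm]
  gcongr
  calc _ ≤ (s + ε) ^ (-ν.re - 1) :=
        mul_le_of_le_one_right (by positivity) (Real.exp_le_one_iff.2 (by simp; positivity))
    _ ≤ s ^ (-ν.re - 1) :=
        Real.rpow_le_rpow_of_nonpos hs0 (by linarith) (by linarith)

/-- For `ν = 0` the integrand is positive; the substitution `r = s + ε` costs the factor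
`exp(εu²)`, which is harmless for `εu² ≤ 1`, while for `εu² ≥ 1` the integral is at most `1`. -/
theorem norm_regMacdonald_zero_le {x u ε : ℝ} (hx : 0 < x) (hu : 0 < u) (hε : 0 ≤ ε) :
    ‖regMacdonald 0 x u ε‖ ≤ 1 + Real.exp 1 * ‖regMacdonald 0 x u 0‖ := by
  set g : ℝ → ℝ := fun r => Real.exp (-(u ^ 2 * r)) *
    (r ^ (-(0 : ℂ).re - 1) * Real.exp (-(x ^ 2 / (4 * r)))) with hg
  have hnorm : ∀ s ∈ Ioi (0 : ℝ),
      ‖(Real.exp (-(u ^ 2 * s)) : ℂ) * heatFactor 0 x (s + 0)‖ = g s := by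
    intro s hs
    rw [add_zero, norm_mul, norm_heatFactor _ _ hs, Complex.norm_real, Real.norm_eq_abs,
      Real.abs_exp]
  have h0 := integrableOn_regMacdonald_integrand (ν := 0) (by simp) hx hu le_rfl
  have hint : IntegrableOn g (Ioi 0) := IntegrableOn.congr_fun h0.norm hnorm measurableSet_Ioi
  have hg0 : ∀ s, 0 < s → 0 ≤ g s := fun s hs => by positivity
  have hA0 : ‖regMacdonald 0 x u 0‖ = ∫ r in Ioi 0, g r := by
    rw [regMacdonald, setIntegral_congr_fun (g := fun s => (g s : ℂ)) measurableSet_Ioi,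
      integral_complex_ofReal, Complex.norm_real,
      Real.norm_of_nonneg (setIntegral_nonneg measurableSet_Ioi hg0)]
    intro s hs
    have hs0 : 0 < s := hs
    simp only [hg, heatFactor, add_zero]
    push_cast [Complex.ofReal_cpow hs0.le]
    simp
  by_cases h : ε * u ^ 2 ≤ 1
  · refine le_add_of_nonneg_of_le zero_le_one ?_
    rw [hA0]
    refine le_trans ?_ (mul_le_mul_of_nonneg_left (integral_Ioi_comp_add_le hint hg0 hε)
      (Real.exp_pos 1).le)
    rw [← integral_const_mul]
    refine norm_integral_le_of_norm_le ((integrableOn_Ioi_comp_add hint hε).const_mul _) ?_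
    filter_upwards [ae_restrict_mem measurableSet_Ioi] with s hs
    have hs0 : 0 < s := hs
    have hsε : 0 < s + ε := by linarith
    rw [norm_mul, norm_heatFactor _ _ hsε, Complex.norm_real, Real.norm_eq_abs, Real.abs_exp, hg]
    simp only
    rw [← mul_assoc (Real.exp 1), ← Real.exp_add]
    gcongr
    linarith
  · push Not at h
    have hε0 : 0 < ε := by
      by_contra! h'
      nlinarith [sq_nonneg u]
    refine le_add_of_le_of_nonneg ?_ (by positivity)
    have hi := (integrableOn_exp_neg_sq_mul hu).const_mul (1 / ε)
    have hv : ∫ s in Ioi (0 : ℝ), 1 / ε * Real.exp (-(u ^ 2 * s)) ≤ 1 := by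
      rw [integral_const_mul, integral_exp_neg_mul_eq (by positivity), div_mul_div_comm, one_mul,
        div_le_one (by positivity)]
      exact h.le
    refine le_trans (norm_integral_le_of_norm_le hi ?_) hv
    filter_upwards [ae_restrict_mem measurableSet_Ioi] with s hs
    have hs0 : 0 < s := hs
    have hsε : 0 < s + ε := by linarith
    rw [norm_mul, norm_heatFactor _ _ hsε, Complex.norm_real, Real.norm_eq_abs, Real.abs_exp,
      mul_comm]
    gcongr
    refine (mul_le_of_le_one_right (by positivity)
      (Real.exp_le_one_iff.2 (by simp; positivity))).trans ?_
    rw [Complex.zero_re, neg_zero, zero_sub, Real.rpow_neg_one, one_div]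
    exact inv_anti₀ hε0 (by linarith)

/-- For imaginary `ν ≠ 0` the integrals are bounded although their absolute values are not:
`(s+ε)^(-ν-1)` has the bounded primitive `(s+ε)^(-ν)/(-ν)`, and the other factors have total
variation at most `2`. -/
theorem norm_regMacdonald_le_of_re_eq_zero {ν : ℂ} (hν : ν.re = 0) (hν0 : ν ≠ 0) {x u ε : ℝ}
    (hx : 0 < x) (hu : 0 < u) (hε : 0 < ε) :
    ‖regMacdonald ν x u ε‖ ≤ 3 / ‖ν‖ := by
  have hν1 : -1 < ν.re := by rw [hν]; norm_num
  have hνn : 0 < ‖ν‖ := norm_pos_iff.2 hν0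
  set E₁ : ℝ → ℝ := fun s => Real.exp (-(u ^ 2 * s)) with hE₁
  set E₂ : ℝ → ℝ := fun s => Real.exp (-(x ^ 2 / (4 * (s + ε)))) with hE₂
  have hd1 : ∀ s : ℝ, HasDerivAt E₁ (E₁ s * -(u ^ 2)) s := by
    intro s
    have := ((hasDerivAt_id s).const_mul (u ^ 2)).neg.exp
    exact this.congr_deriv (by simp [hE₁])
  have hd2 : ∀ s : ℝ, 0 ≤ s → HasDerivAt E₂ (E₂ s * (x ^ 2 / (4 * (s + ε) ^ 2))) s := by
    intro s hs
    have hsε : s + ε ≠ 0 := by linarith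
    have := (((hasDerivAt_const s (x ^ 2)).div (((hasDerivAt_id s).add_const ε).const_mul 4)
      (by simpa using hsε)).neg).exp
    refine this.congr_deriv ?_
    simp only [hE₂, id, Pi.neg_apply, Pi.div_apply]
    field_simp
    ring
  have hE₁1 : ∀ s : ℝ, 0 ≤ s → E₁ s ≤ 1 := fun s hs =>
    Real.exp_le_one_iff.2 (by simp; positivity)
  have hE₂1 : ∀ s : ℝ, 0 ≤ s → E₂ s ≤ 1 := fun s hs =>
    Real.exp_le_one_iff.2 (by simp; positivity)
  have hE₂lim : Tendsto E₂ atTop (𝓝 1) := by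
    have h1 : Tendsto (fun s : ℝ => 4 * (s + ε)) atTop atTop :=
      Tendsto.const_mul_atTop (by norm_num) (tendsto_atTop_add_const_right _ _ tendsto_id)
    have h2 := (h1.const_div_atTop (x ^ 2)).neg.rexp
    simpa using h2
  have hE₁lim : Tendsto E₁ atTop (𝓝 0) := by
    refine Real.tendsto_exp_neg_atTop_nhds_zero.comp ?_
    exact Tendsto.const_mul_atTop (by positivity) tendsto_id
  have hi1 := (integrableOn_exp_neg_sq_mul hu).const_mul (u ^ 2)
  have hi2 : IntegrableOn (fun s => E₂ s * (x ^ 2 / (4 * (s + ε) ^ 2))) (Ioi 0) :=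
    integrableOn_Ioi_deriv_of_nonneg' (fun s hs => hd2 s hs)
      (fun s hs => by positivity) hE₂lim
  have hv2 : ∫ s in Ioi (0 : ℝ), E₂ s * (x ^ 2 / (4 * (s + ε) ^ 2)) ≤ 1 := by
    rw [integral_Ioi_of_hasDerivAt_of_nonneg' (fun s hs => hd2 s hs)
      (fun s hs => by positivity) hE₂lim]
    have : 0 < E₂ 0 := Real.exp_pos _
    linarith
  have hv1 : ∫ s in Ioi (0 : ℝ), u ^ 2 * Real.exp (-(u ^ 2 * s)) = 1 := by
    rw [integral_const_mul, integral_exp_neg_mul_eq (by positivity)]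
    field_simp
  set G : ℝ → ℂ := fun s => ((E₁ s * E₂ s : ℝ) : ℂ) with hG
  set G' : ℝ → ℂ := fun s =>
    ((E₁ s * -(u ^ 2) * E₂ s + E₁ s * (E₂ s * (x ^ 2 / (4 * (s + ε) ^ 2))) : ℝ) : ℂ) with hG'
  set k : ℝ → ℂ := fun s => ((s + ε : ℝ) : ℂ) ^ (-ν) / (-ν) with hk
  set k' : ℝ → ℂ := fun s => ((s + ε : ℝ) : ℂ) ^ (-ν - 1) with hk'
  have hkn : ∀ s : ℝ, 0 ≤ s → ‖k s‖ = 1 / ‖ν‖ := by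
    intro s hs
    rw [hk, norm_div, Complex.norm_cpow_eq_rpow_re_of_pos (by linarith), norm_neg]
    simp [hν]
  have hGd : ∀ s ∈ Ioi (0 : ℝ), HasDerivAt G (G' s) s := fun s hs =>
    ((hd1 s).mul (hd2 s (le_of_lt hs))).ofReal_comp
  have hkd : ∀ s : ℝ, 0 ≤ s → HasDerivAt k (k' s) s := by
    intro s hs
    have hsε : 0 < s + ε := by linarith
    have hsεc : ((s + ε : ℝ) : ℂ) ≠ 0 := by exact_mod_cast hsε.ne'
    have h := (hasDerivAt_ofReal_cpow_div hsε (-ν)).comp_add_const s ε |>.div_const (-ν)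
    refine h.congr_deriv ?_
    simp only [hk']
    rw [Complex.cpow_sub _ _ hsεc, Complex.cpow_one]
    field_simp
  have hGm : Measurable G := by fun_prop
  have hkm : Measurable k := by
    have : Measurable fun t : ℝ => (t : ℂ) ^ (-ν) := Complex.measurable_ofReal.pow_const _
    exact (this.comp (by fun_prop : Measurable fun s : ℝ => s + ε)).div_const _
  have hG'm : Measurable G' := by fun_prop
  have hG'b : ∀ s ∈ Ioi (0 : ℝ), ‖G' s * k s‖ ≤ 1 / ‖ν‖ *
      (u ^ 2 * Real.exp (-(u ^ 2 * s)) + E₂ s * (x ^ 2 / (4 * (s + ε) ^ 2))) := by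
    intro s hs
    have hs0 : 0 ≤ s := le_of_lt hs
    rw [norm_mul, hkn s hs0, mul_comm, hG', Complex.norm_real, Real.norm_eq_abs]
    refine mul_le_mul_of_nonneg_left ((abs_add_le _ _).trans (add_le_add ?_ ?_)) (by positivity)
    · rw [abs_mul, abs_mul, abs_neg, abs_of_nonneg (Real.exp_pos _).le,
        abs_of_nonneg (Real.exp_pos _).le, abs_of_nonneg (sq_nonneg u), mul_comm (Real.exp _)]
      exact mul_le_of_le_one_right (by positivity) (hE₂1 s hs0)
    · rw [abs_of_nonneg (by positivity)]
      exact mul_le_of_le_one_left (by positivity) (hE₁1 s hs0)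
  have hbi := (hi1.add hi2).const_mul (1 / ‖ν‖)
  have hG'k : IntegrableOn (G' * k) (Ioi 0) := by
    refine Integrable.mono' hbi (hG'm.mul hkm).aestronglyMeasurable ?_
    filter_upwards [ae_restrict_mem measurableSet_Ioi] with s hs using hG'b s hs
  have hGk' : IntegrableOn (G * k') (Ioi 0) := by
    refine (integrableOn_regMacdonald_integrand hν1 hx hu hε.le).congr_fun (fun s hs => ?_)
      measurableSet_Ioi
    simp only [hG, hk', hE₁, hE₂, heatFactor, Pi.mul_apply]
    push_cast
    ring
  have hzero : Tendsto (G * k) (𝓝[>] 0) (𝓝 (G 0 * k 0)) := by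
    refine Tendsto.mono_left ?_ nhdsWithin_le_nhds
    have h1 : HasDerivAt G _ 0 := ((hd1 0).mul (hd2 0 le_rfl)).ofReal_comp
    exact (h1.continuousAt.mul (hkd 0 le_rfl).continuousAt).tendsto
  have hinf : Tendsto (G * k) atTop (𝓝 0) := by
    have h1 : Tendsto (fun s => E₁ s * (1 / ‖ν‖)) atTop (𝓝 0) := by
      simpa using hE₁lim.mul_const (1 / ‖ν‖)
    refine squeeze_zero_norm' ?_ h1
    filter_upwards [eventually_ge_atTop 0] with s hs
    rw [Pi.mul_apply, norm_mul, hkn s hs, hG, Complex.norm_real, Real.norm_of_nonneg (by positivity)]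
    gcongr
    exact mul_le_of_le_one_right (by positivity) (hE₂1 s hs)
  have key := integral_Ioi_mul_deriv_eq_deriv_mul hGd (fun s hs => hkd s (le_of_lt hs)) hGk' hG'k
    hzero hinf
  have hA : regMacdonald ν x u ε = ∫ s in Ioi (0 : ℝ), G s * k' s := by
    refine setIntegral_congr_fun measurableSet_Ioi fun s _ => ?_
    simp only [hG, hk', hE₁, hE₂, heatFactor]
    push_cast
    ring
  have hint : ‖∫ s in Ioi (0 : ℝ), G' s * k s‖ ≤ 1 / ‖ν‖ * 2 := by
    refine (norm_integral_le_of_norm_le hbi (by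
      filter_upwards [ae_restrict_mem measurableSet_Ioi] with s hs using hG'b s hs)).trans ?_
    rw [integral_const_mul]
    refine mul_le_mul_of_nonneg_left ?_ (by positivity)
    simp only [Pi.add_apply]
    rw [integral_add hi1 hi2]
    linarith
  have h0 : ‖G 0 * k 0‖ ≤ 1 / ‖ν‖ := by
    rw [norm_mul, hkn 0 le_rfl, hG, Complex.norm_real, Real.norm_of_nonneg (by positivity)]
    refine mul_le_of_le_one_left (by positivity) ?_
    exact mul_le_one₀ (hE₁1 0 le_rfl) (Real.exp_pos _).le (hE₂1 0 le_rfl)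
  rw [hA, key, zero_sub]
  calc _ ≤ ‖-(G 0 * k 0)‖ + ‖∫ s in Ioi (0 : ℝ), G' s * k s‖ := norm_sub_le _ _
    _ ≤ 1 / ‖ν‖ + 1 / ‖ν‖ * 2 := by
      rw [norm_neg]
      exact add_le_add h0 hint
    _ = 3 / ‖ν‖ := by ring

/-- Uniformly in the regularization, the integrals are controlled for small `xu` by the Macdonald
function itself, up to an additive constant that only matters for `Re ν = 0`. -/
theorem exists_norm_regMacdonald_le {ν : ℂ} (hν : -1 < ν.re) :
    ∃ C z₀ : ℝ, 0 < C ∧ 0 < z₀ ∧ ∀ x u ε : ℝ, 0 < x → 0 < u → 0 < ε → x * u ≤ z₀ →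
      ‖regMacdonald ν x u ε‖ ≤ C * (1 + (u / x) ^ ν.re * ‖besselK ν (x * u)‖) := by
  rcases lt_trichotomy ν.re 0 with h | h | h
  · obtain ⟨c, z₀, hc, hz₀, hK⟩ := exists_le_norm_besselK (μ := -ν) (by simpa using h)
    have hΓ : 0 < Real.Gamma (-ν.re) := Real.Gamma_pos_of_pos (by linarith)
    refine ⟨Real.Gamma (-ν.re) / c, z₀, by positivity, hz₀, fun x u ε hx hu hε hz => ?_⟩
    refine (norm_regMacdonald_le_of_re_neg hν h hu hε.le).trans ?_
    have hk := hK (x * u) (by positivity) hz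
    rw [besselK_neg, Complex.neg_re] at hk
    have e : u ^ (2 * ν.re) = (u / x) ^ ν.re * (x * u) ^ ν.re := by
      have := div_rpow_eq_mul_rpow hu hx (-ν.re)
      rw [neg_neg, mul_comm u x, show -2 * -ν.re = 2 * ν.re by ring] at this
      rw [this, ← inv_div u x, Real.inv_rpow (by positivity), Real.rpow_neg (by positivity), inv_inv]
    rw [Real.rpow_neg (by positivity), inv_mul_eq_div, le_div_iff₀ (by positivity)] at hk
    rw [div_mul_eq_mul_div, le_div_iff₀ hc, e, mul_assoc]
    refine mul_le_mul_of_nonneg_left ?_ hΓ.le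
    have hq : 0 ≤ (u / x) ^ ν.re := by positivity
    nlinarith [mul_le_mul_of_nonneg_left hk hq]
  · by_cases h0 : ν = 0
    · subst h0
      refine ⟨2 * Real.exp 1, 1, by positivity, one_pos, fun x u ε hx hu hε _ => ?_⟩
      refine (norm_regMacdonald_zero_le hx hu hε.le).trans ?_
      rw [regMacdonald_zero_eq hx hu (integrableOn_regMacdonald_integrand hν hx hu le_rfl)]
      simp only [Complex.cpow_zero, mul_one, norm_mul, Complex.norm_ofNat, Complex.zero_re,
        Real.rpow_zero, one_mul]
      have : 1 ≤ Real.exp 1 := Real.one_le_exp zero_le_one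
      nlinarith
    · refine ⟨3 / ‖ν‖, 1, by positivity, one_pos, fun x u ε hx hu hε _ => ?_⟩
      refine (norm_regMacdonald_le_of_re_eq_zero h h0 hx hu hε).trans ?_
      exact le_mul_of_one_le_right (by positivity) (le_add_of_nonneg_right (by positivity))
  · obtain ⟨c, z₀, hc, hz₀, hK⟩ := exists_le_norm_besselK h
    have hΓ : 0 < Real.Gamma ν.re := Real.Gamma_pos_of_pos h
    refine ⟨4 ^ ν.re * Real.Gamma ν.re / c, z₀, by positivity, hz₀, fun x u ε hx hu hε hz => ?_⟩
    refine (norm_regMacdonald_le_of_re_pos h hx hε.le).trans ?_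
    have hk := hK (x * u) (by positivity) hz
    rw [div_rpow_eq_mul_rpow hx hu, div_mul_eq_mul_div, le_div_iff₀ hc, mul_assoc]
    refine mul_le_mul_of_nonneg_left ?_ (by positivity)
    have hp : 0 < (x * u) ^ ν.re := by positivity
    rw [Real.rpow_neg (by positivity)]
    have hq : 0 ≤ (u / x) ^ ν.re := by positivity
    have hk' : ((x * u) ^ ν.re)⁻¹ * c ≤ ‖besselK ν (x * u)‖ := by
      rw [inv_mul_le_iff₀ hp]
      exact hk
    nlinarith [mul_le_mul_of_nonneg_left hk' hq]

/-! ### The inner identity for a fixed argument of `g` -/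

theorem integrableOn_prod_Ioi_iff {F : ℝ × ℝ → ℂ} :
    IntegrableOn F (Ioi (0 : ℝ) ×ˢ Ioi (0 : ℝ)) ↔
      Integrable F ((volume.restrict (Ioi 0)).prod (volume.restrict (Ioi 0))) := by
  rw [IntegrableOn, Measure.volume_eq_prod, Measure.prod_restrict]

theorem kKernel_comm (ν : ℂ) (x y : ℝ) : kKernel ν x y = kKernel ν y x := by
  rw [kKernel, kKernel, mul_comm x y]

theorem norm_kKernel (ν : ℂ) {x u : ℝ} (hx : 0 < x) (hu : 0 < u) :
    ‖kKernel ν x u‖ = x ^ (1 / 2 : ℝ) * u ^ (1 / 2 : ℝ) * ‖besselK ν (x * u)‖ := by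
  rw [kKernel, norm_mul, Complex.norm_real, Real.norm_of_nonneg (Real.sqrt_nonneg _),
    Real.sqrt_eq_rpow, Real.mul_rpow hx.le hu.le]

theorem const_mul_regMacdonald_zero {ν : ℂ} (hν : -1 < ν.re) {x u : ℝ} (hx : 0 < x) (hu : 0 < u) :
    (2 : ℂ) ^ (-ν) / 2 * (x : ℂ) ^ (ν + 1 / 2) * regMacdonald ν x u 0 =
      (u : ℂ) ^ (ν - 1 / 2) * kKernel ν x u := by
  have hxc : (x : ℂ) ≠ 0 := by exact_mod_cast hx.ne'
  have huc : (u : ℂ) ≠ 0 := by exact_mod_cast hu.ne'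
  have h2 : (2 : ℂ) ^ ν ≠ 0 := by simp [Complex.cpow_eq_zero_iff]
  have hxν : (x : ℂ) ^ ν ≠ 0 := by simp [Complex.cpow_eq_zero_iff, hxc]
  have huh : (u : ℂ) ^ (1 / 2 : ℂ) ≠ 0 := by simp [Complex.cpow_eq_zero_iff, huc]
  rw [regMacdonald_zero_eq hx hu (integrableOn_regMacdonald_integrand hν hx hu le_rfl), kKernel,
    ofReal_sqrt_eq_cpow (by positivity), Complex.ofReal_mul,
    Complex.mul_cpow_ofReal_nonneg hx.le hu.le, Complex.cpow_add _ _ hxc,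
    Complex.cpow_sub _ _ huc, Complex.cpow_neg]
  have h3 : ((2 * u / x : ℝ) : ℂ) ^ ν = (2 : ℂ) ^ ν * (u : ℂ) ^ ν / (x : ℂ) ^ ν := by
    rw [eq_div_iff hxν, ← Complex.mul_cpow_ofReal_nonneg (by positivity) hx.le,
      ← Complex.ofReal_mul, div_mul_cancel₀ _ hx.ne', Complex.ofReal_mul,
      Complex.mul_cpow_ofReal_nonneg (by norm_num) hu.le]
    norm_num
  rw [h3]
  field_simp

/-- The majorant in `x`, for fixed `u`: near `0` it is the Macdonald kernel, elsewhere the Gaussian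
factor in `heatFactor` already gives the weight `min(1,x)^(Re ν+1/2)`. -/
theorem exists_norm_cpow_mul_regMacdonald_le {ν : ℂ} (hν : -1 < ν.re) {u : ℝ} (hu : 0 < u) :
    ∃ C : ℝ, ∀ x ε : ℝ, 0 < x → 0 < ε →
      ‖(x : ℂ) ^ (ν + 1 / 2) * regMacdonald ν x u ε‖ ≤
        C * ((min 1 x) ^ (ν.re + 1 / 2) + ‖kKernel ν x u‖) := by
  obtain ⟨C₁, z₀, hC₁, hz₀, h₁⟩ := exists_norm_regMacdonald_le hν
  set σ := ν.re + 1 / 2 with hσ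
  set q := ν.re + 1 with hq
  have hq0 : 0 < q := by rw [hq]; linarith
  set X := min 1 (z₀ / u) with hX
  have hX0 : 0 < X := lt_min one_pos (by positivity)
  have hX1 : X ≤ 1 := min_le_left _ _
  set d := min (X ^ σ) ((1 : ℝ) ^ σ) with hd
  have hd0 : 0 < d := lt_min (by positivity) (by positivity)
  set B := (4 * q) ^ q * X ^ (σ - 2 * q) * (1 / u ^ 2) with hB
  have hB0 : 0 ≤ B := by positivity
  refine ⟨C₁ + C₁ * u ^ (ν.re - 1 / 2) + B / d, fun x ε hx hε => ?_⟩
  have hw : 0 ≤ (min 1 x) ^ σ := by positivity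
  have hk : 0 ≤ ‖kKernel ν x u‖ := norm_nonneg _
  have hC2 : 0 ≤ C₁ * u ^ (ν.re - 1 / 2) := by positivity
  have hBd : 0 ≤ B / d := by positivity
  have hnx : ‖(x : ℂ) ^ (ν + 1 / 2)‖ = x ^ σ := by
    rw [Complex.norm_cpow_eq_rpow_re_of_pos hx]
    simp [hσ]
  rw [norm_mul, hnx]
  rcases le_total x X with h | h
  · have hxu : x * u ≤ z₀ := by
      rw [← le_div_iff₀ hu]
      exact h.trans (min_le_right _ _)
    have e : x ^ σ * (u / x) ^ ν.re = u ^ (ν.re - 1 / 2) * (x ^ (1 / 2 : ℝ) * u ^ (1 / 2 : ℝ)) := by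
      have := (Real.rpow_pos_of_pos hx ν.re).ne'
      have := (Real.rpow_pos_of_pos hu (1 / 2)).ne'
      rw [hσ, Real.rpow_add hx, Real.div_rpow hu.le hx.le, Real.rpow_sub hu]
      field_simp
    rw [min_eq_right (h.trans hX1)] at hw ⊢
    calc x ^ σ * ‖regMacdonald ν x u ε‖
        ≤ x ^ σ * (C₁ * (1 + (u / x) ^ ν.re * ‖besselK ν (x * u)‖)) := by
          gcongr
          exact h₁ x u ε hx hu hε hxu
      _ = C₁ * x ^ σ + C₁ * (x ^ σ * (u / x) ^ ν.re) * ‖besselK ν (x * u)‖ := by ring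
      _ = C₁ * x ^ σ + C₁ * u ^ (ν.re - 1 / 2) * ‖kKernel ν x u‖ := by
        rw [e, norm_kKernel ν hx hu]
        ring
      _ ≤ _ := by nlinarith [mul_nonneg hC₁.le hk, mul_nonneg hC2 hw, mul_nonneg hBd hw,
        mul_nonneg hBd hk]
  · have hwd : d ≤ (min 1 x) ^ σ :=
      min_rpow_le_rpow σ hX0 ⟨le_min hX1 h, min_le_left _ _⟩
    calc x ^ σ * ‖regMacdonald ν x u ε‖
        ≤ x ^ σ * ((4 * q) ^ q * x ^ (-2 * q) * (1 / u ^ 2)) := by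
          gcongr
          exact norm_regMacdonald_le hν hx hu hε.le
      _ = (4 * q) ^ q * x ^ (σ - 2 * q) * (1 / u ^ 2) := by
        have : x ^ (σ - 2 * q) = x ^ σ * x ^ (-2 * q) := by
          rw [← Real.rpow_add hx]
          ring_nf
        rw [this]
        ring
      _ ≤ B := by
        rw [hB]
        gcongr ?_ * ?_ * ?_
        exact Real.rpow_le_rpow_of_nonpos hX0 h (by rw [hσ, hq]; linarith)
      _ ≤ B / d * (min 1 x) ^ σ := by
        rw [div_mul_eq_mul_div, le_div_iff₀ hd0]
        gcongr
      _ ≤ _ := by nlinarith [mul_nonneg hC₁.le hk, mul_nonneg hC2 hw, mul_nonneg hC₁.le hw,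
        mul_nonneg hC2 hk, mul_nonneg hBd hk]

/-- The majorant in `u`, for fixed `x`: near `0` it is the Macdonald kernel, elsewhere the decay
`1/u²` of the Widder kernel. -/
theorem exists_norm_mul_regMacdonald_le {ν : ℂ} (hν : -1 < ν.re) {x : ℝ} (hx : 0 < x) :
    ∃ C : ℝ, ∀ u ε : ℝ, 0 < u → 0 < ε →
      ‖(u : ℂ) ^ (-ν + 1 / 2) * regMacdonald ν x u ε‖ ≤
        C * (‖(u : ℂ) ^ (-ν + 1 / 2)‖ * (1 / (u ^ 2 + 1)) + ‖kKernel ν u x‖) := by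
  obtain ⟨C₁, z₀, hC₁, hz₀, h₁⟩ := exists_norm_regMacdonald_le hν
  set q := ν.re + 1 with hq
  have hq0 : 0 < q := by rw [hq]; linarith
  set U := z₀ / x with hU
  have hU0 : 0 < U := by positivity
  set B := (4 * q) ^ q * x ^ (-2 * q) * (1 + 1 / U ^ 2) with hB
  have hB0 : 0 ≤ B := by positivity
  refine ⟨C₁ * (U ^ 2 + 1) + C₁ * x ^ (-ν.re - 1 / 2) + B, fun u ε hu hε => ?_⟩
  have hk : 0 ≤ ‖kKernel ν u x‖ := norm_nonneg _
  have hnu : ‖(u : ℂ) ^ (-ν + 1 / 2)‖ = u ^ (-ν.re + 1 / 2) := by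
    rw [Complex.norm_cpow_eq_rpow_re_of_pos hu]
    simp
  rw [norm_mul, hnu]
  set τ := -ν.re + 1 / 2 with hτ
  have hv : 0 ≤ u ^ τ * (1 / (u ^ 2 + 1)) := by positivity
  have hC2 : 0 ≤ C₁ * x ^ (-ν.re - 1 / 2) := by positivity
  have hC3 : 0 ≤ C₁ * (U ^ 2 + 1) := by positivity
  rcases le_total u U with h | h
  · have hxu : x * u ≤ z₀ := by
      rw [mul_comm, ← le_div_iff₀ hx]
      exact h
    have e : u ^ τ * (u / x) ^ ν.re = x ^ (-ν.re - 1 / 2) * (u ^ (1 / 2 : ℝ) * x ^ (1 / 2 : ℝ)) := by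
      have := (Real.rpow_pos_of_pos hu ν.re).ne'
      have := (Real.rpow_pos_of_pos hx (1 / 2)).ne'
      rw [hτ, Real.rpow_add hu, Real.div_rpow hu.le hx.le, Real.rpow_sub hx, Real.rpow_neg hu.le,
        Real.rpow_neg hx.le]
      field_simp
    have h2 : u ^ τ ≤ (U ^ 2 + 1) * (u ^ τ * (1 / (u ^ 2 + 1))) := by
      rw [mul_one_div, mul_div_assoc', le_div_iff₀ (by positivity), mul_comm]
      gcongr
    calc u ^ τ * ‖regMacdonald ν x u ε‖
        ≤ u ^ τ * (C₁ * (1 + (u / x) ^ ν.re * ‖besselK ν (x * u)‖)) := by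
          gcongr
          exact h₁ x u ε hx hu hε hxu
      _ = C₁ * u ^ τ + C₁ * (u ^ τ * (u / x) ^ ν.re) * ‖besselK ν (x * u)‖ := by ring
      _ = C₁ * u ^ τ + C₁ * x ^ (-ν.re - 1 / 2) * ‖kKernel ν u x‖ := by
        rw [e, norm_kKernel ν hu hx, mul_comm x u]
        ring
      _ ≤ _ := by nlinarith [mul_le_mul_of_nonneg_left h2 hC₁.le, mul_nonneg hC2 hv,
        mul_nonneg hC3 hk, mul_nonneg hB0 hv, mul_nonneg hB0 hk]
  · have h2 : 1 / u ^ 2 ≤ (1 + 1 / U ^ 2) * (1 / (u ^ 2 + 1)) := by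
      rw [mul_one_div, div_le_div_iff₀ (by positivity) (by positivity), one_mul, add_mul, one_mul]
      have : 1 ≤ 1 / U ^ 2 * u ^ 2 := by
        rw [one_div_mul_eq_div, le_div_iff₀ (by positivity), one_mul]
        gcongr
      linarith
    calc u ^ τ * ‖regMacdonald ν x u ε‖
        ≤ u ^ τ * ((4 * q) ^ q * x ^ (-2 * q) * (1 / u ^ 2)) := by
          gcongr
          exact norm_regMacdonald_le hν hx hu hε.le
      _ ≤ u ^ τ * ((4 * q) ^ q * x ^ (-2 * q) * ((1 + 1 / U ^ 2) * (1 / (u ^ 2 + 1)))) := by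
        gcongr
      _ = B * (u ^ τ * (1 / (u ^ 2 + 1))) := by
        rw [hB]
        ring
      _ ≤ _ := by nlinarith [mul_nonneg hC2 hk, mul_nonneg hC2 hv, mul_nonneg hC3 hv,
        mul_nonneg hC3 hk, mul_nonneg hB0 hk]

/-- The inner identity when the integral over `(y, u)` converges absolutely: for fixed `u`, insert
the convergence factor `exp(-εy²)`, interchange the integrals and let `ε → 0`. -/
theorem integral_hankelTransform_div {ν : ℂ} (hν : -1 < ν.re) {f : ℝ → ℂ}
    (hf : ∀ y : ℝ, 0 < y → IntegrableOn (fun x : ℝ => hankelKernel ν x y * f x) (Ioi 0))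
    {u : ℝ} (hu : 0 < u)
    (hH : IntegrableOn (fun y : ℝ => (y : ℂ) ^ (ν + 1 / 2) * hankelTransform ν f y *
      ((1 / (u ^ 2 + y ^ 2) : ℝ) : ℂ)) (Ioi 0))
    (hK : IntegrableOn (fun x : ℝ => kKernel ν x u * f x) (Ioi 0)) :
    ∫ y in Ioi (0 : ℝ), (y : ℂ) ^ (ν + 1 / 2) * hankelTransform ν f y *
      ((1 / (u ^ 2 + y ^ 2) : ℝ) : ℂ) = (u : ℂ) ^ (ν - 1 / 2) * kTransform ν f u := by
  have hf' : ∀ y : ℝ, 0 < y → IntegrableOn (fun x : ℝ => rootBessel ν (x * y) * f x) (Ioi 0) :=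
    fun y hy => integrableOn_rootBessel_mul hf hy
  have hfm := aestronglyMeasurable_of_hankel hν hf'
  have hwf := integrableOn_weight_of_hankel hν hf'
  obtain ⟨C, hC, hb⟩ := exists_norm_rootBessel_mul_le hν
  obtain ⟨D, hD⟩ := exists_norm_cpow_mul_regMacdonald_le hν hu
  set κ : ℂ := (2 : ℂ) ^ (-ν) / 2 with hκ
  set σ := ν.re + 1 / 2 with hσ
  have hσ1 : -1 < 2 * σ := by rw [hσ]; linarith
  have hprod : ∀ ε : ℝ, 0 < ε → Integrable (fun p : ℝ × ℝ =>
      ((p.2 : ℂ) ^ (ν + 1 / 2) * rootBessel ν (p.1 * p.2) * (Real.exp (-ε * p.2 ^ 2) : ℂ) *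
        ((1 / (u ^ 2 + p.2 ^ 2) : ℝ) : ℂ)) * f p.1)
      ((volume.restrict (Ioi 0)).prod (volume.restrict (Ioi 0))) := by
    intro ε hε
    have h1 := Integrable.mul_prod hwf
      (((integrableOn_rpow_mul_exp_neg_mul_sq hε (s := σ) (by linarith)).add
      (integrableOn_rpow_mul_exp_neg_mul_sq hε hσ1)).const_mul (C * (1 / u ^ 2)))
    refine Integrable.mono' h1 ?_ ?_
    · have h2 : Measurable fun t : ℝ => (t : ℂ) ^ (ν + 1 / 2) :=
        Complex.measurable_ofReal.pow_const _
      refine AEStronglyMeasurable.mul (Measurable.aestronglyMeasurable ?_) hfm.comp_fst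
      exact (((h2.comp measurable_snd).mul ((measurable_rootBessel hν).comp (by fun_prop))).mul
        (by fun_prop)).mul (by fun_prop)
    · rw [Measure.prod_restrict]
      filter_upwards [ae_restrict_mem (measurableSet_Ioi.prod measurableSet_Ioi)] with p hp
      obtain ⟨hx, hy⟩ : 0 < p.1 ∧ 0 < p.2 := hp
      have hre : (ν + 1 / 2).re = σ := by simp [hσ]
      rw [norm_mul, norm_mul, norm_mul, norm_mul, Complex.norm_cpow_eq_rpow_re_of_pos hy,
        Complex.norm_real, Complex.norm_real, Real.norm_eq_abs, Real.abs_exp,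
        Real.norm_of_nonneg (by positivity), hre]
      have hyσ : 0 ≤ p.2 ^ σ := by positivity
      calc _ ≤ p.2 ^ σ * (C * ((min 1 p.1) ^ σ * (1 + p.2 ^ σ))) * Real.exp (-ε * p.2 ^ 2) *
            (1 / u ^ 2) * ‖f p.1‖ := by
            gcongr
            · exact hb _ _ hx hy
            · exact le_add_of_nonneg_right (sq_nonneg _)
        _ = _ := by
          simp only [Pi.add_apply]
          have h2 : p.2 ^ (2 * σ) = p.2 ^ σ * p.2 ^ σ := by rw [two_mul, Real.rpow_add hy]
          rw [h2]
          generalize p.2 ^ σ = z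
          ring
  have hx_inner : ∀ ε : ℝ, 0 < ε → ∀ x ∈ Ioi (0 : ℝ), ∫ y in Ioi (0 : ℝ),
      ((y : ℂ) ^ (ν + 1 / 2) * rootBessel ν (x * y) * (Real.exp (-ε * y ^ 2) : ℂ) *
        ((1 / (u ^ 2 + y ^ 2) : ℝ) : ℂ)) * f x =
      κ * ((x : ℂ) ^ (ν + 1 / 2) * regMacdonald ν x u ε) * f x := by
    intro ε hε x hx
    rw [integral_mul_const, integral_rootBessel_mul_exp_div hν hx hu hε, ← mul_assoc κ]
  have hreg : ∀ ε : ℝ, 0 < ε → ∫ y in Ioi (0 : ℝ), (y : ℂ) ^ (ν + 1 / 2) * hankelTransform ν f y *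
      ((1 / (u ^ 2 + y ^ 2) : ℝ) : ℂ) * (Real.exp (-ε * y ^ 2) : ℂ) =
      ∫ x in Ioi (0 : ℝ), κ * ((x : ℂ) ^ (ν + 1 / 2) * regMacdonald ν x u ε) * f x := by
    intro ε hε
    rw [← setIntegral_congr_fun measurableSet_Ioi (hx_inner ε hε),
      integral_integral_swap (f := fun x y : ℝ => ((y : ℂ) ^ (ν + 1 / 2) * rootBessel ν (x * y) *
        (Real.exp (-ε * y ^ 2) : ℂ) * ((1 / (u ^ 2 + y ^ 2) : ℝ) : ℂ)) * f x) (hprod ε hε)]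
    refine setIntegral_congr_fun measurableSet_Ioi fun y hy => ?_
    have hH : hankelTransform ν f y = ∫ x in Ioi (0 : ℝ), rootBessel ν (x * y) * f x :=
      setIntegral_congr_fun measurableSet_Ioi fun x hx => by simp only [hankelKernel_eq ν hx hy]
    rw [hH, mul_assoc, mul_right_comm, ← integral_const_mul]
    refine integral_congr_ae (.of_forall fun x => ?_)
    simp only
    ring
  have hlimL : Tendsto (fun ε : ℝ => ∫ y in Ioi (0 : ℝ), (y : ℂ) ^ (ν + 1 / 2) *
      hankelTransform ν f y * ((1 / (u ^ 2 + y ^ 2) : ℝ) : ℂ) * (Real.exp (-ε * y ^ 2) : ℂ))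
      (𝓝[>] 0) (𝓝 (∫ y in Ioi (0 : ℝ), (y : ℂ) ^ (ν + 1 / 2) * hankelTransform ν f y *
      ((1 / (u ^ 2 + y ^ 2) : ℝ) : ℂ))) := by
    refine tendsto_integral_filter_of_dominated_convergence _ (.of_forall fun ε =>
      hH.aestronglyMeasurable.mul (by fun_prop)) ?_ hH.norm (.of_forall fun y => ?_)
    · filter_upwards [self_mem_nhdsWithin] with ε hε
      refine .of_forall fun y => ?_
      rw [norm_mul]
      refine mul_le_of_le_one_right (norm_nonneg _) ?_
      rw [Complex.norm_real, Real.norm_eq_abs, Real.abs_exp, Real.exp_le_one_iff]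
      have : 0 < ε := hε
      nlinarith [sq_nonneg y]
    · refine Tendsto.mono_left ?_ nhdsWithin_le_nhds
      have hc : Continuous fun ε : ℝ => (y : ℂ) ^ (ν + 1 / 2) *
          hankelTransform ν f y * ((1 / (u ^ 2 + y ^ 2) : ℝ) : ℂ) *
          (Real.exp (-ε * y ^ 2) : ℂ) := by fun_prop
      simpa using hc.tendsto 0
  have hlimR : Tendsto (fun ε : ℝ => ∫ x in Ioi (0 : ℝ),
      κ * ((x : ℂ) ^ (ν + 1 / 2) * regMacdonald ν x u ε) * f x) (𝓝[>] 0)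
      (𝓝 (∫ x in Ioi (0 : ℝ), (u : ℂ) ^ (ν - 1 / 2) * (kKernel ν x u * f x))) := by
    refine tendsto_integral_filter_of_dominated_convergence
      (fun x => ‖κ‖ * D * ((min 1 x) ^ σ * ‖f x‖ + ‖kKernel ν x u * f x‖)) ?_ ?_
      ((hwf.add hK.norm).const_mul _) ?_
    · filter_upwards [self_mem_nhdsWithin] with ε hε
      have h1 := (hprod ε hε).integral_prod_left.aestronglyMeasurable
      refine h1.congr ?_
      filter_upwards [ae_restrict_mem measurableSet_Ioi] with x hx
      exact hx_inner ε hε x hx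
    · filter_upwards [self_mem_nhdsWithin] with ε hε
      filter_upwards [ae_restrict_mem measurableSet_Ioi] with x hx
      rw [norm_mul, norm_mul]
      calc _ ≤ ‖κ‖ * (D * ((min 1 x) ^ σ + ‖kKernel ν x u‖)) * ‖f x‖ := by
            gcongr
            exact hD x ε hx hε
        _ = _ := by
          rw [norm_mul]
          ring
    · filter_upwards [ae_restrict_mem measurableSet_Ioi] with x hx
      have h1 := ((tendsto_regMacdonald_zero hν hx hu).const_mul
        (κ * (x : ℂ) ^ (ν + 1 / 2))).mul_const (f x)
      rw [const_mul_regMacdonald_zero hν hx hu] at h1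
      simpa only [mul_assoc] using h1
  have heq := tendsto_nhds_unique hlimL (hlimR.congr' ?_)
  · rw [heq, integral_const_mul, kTransform]
  · filter_upwards [self_mem_nhdsWithin] with ε hε
    exact (hreg ε hε).symm

/-! ### The inner identity for a fixed argument of `f` -/

/-- The inner identity when the integral over `(y, x)` converges absolutely: for fixed `x`, insert
`exp(-εy²) - exp(-Ty²)`, interchange the integrals and let `ε → 0`, `T → ∞`. The second exponential
makes the factor vanish at `y = 0`, where the interchange could fail otherwise. -/
theorem integral_rootBessel_mul_widderTransform {ν : ℂ} (hν : -1 < ν.re) {g : ℝ → ℂ}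
    (hg : ∀ y : ℝ, 0 < y →
      IntegrableOn (fun u : ℝ => widderKernel u y * widderWeight ν g u) (Ioi 0))
    {x : ℝ} (hx : 0 < x)
    (hH : IntegrableOn (fun y : ℝ => (y : ℂ) ^ (ν + 1 / 2) * rootBessel ν (x * y) *
      widderTransform (widderWeight ν g) y) (Ioi 0))
    (hK : IntegrableOn (fun u : ℝ => kKernel ν u x * g u) (Ioi 0)) :
    ∫ y in Ioi (0 : ℝ), (y : ℂ) ^ (ν + 1 / 2) * rootBessel ν (x * y) *
      widderTransform (widderWeight ν g) y = kTransform ν g x := by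
  set G : ℝ → ℂ := fun u => (u : ℂ) ^ (-ν + 1 / 2) * g u with hG
  have hGpt : ∀ y : ℝ, ∀ u ∈ Ioi (0 : ℝ), widderKernel u y * widderWeight ν g u =
      ((1 / (u ^ 2 + y ^ 2) : ℝ) : ℂ) * G u := by
    intro y u hu
    have hu0 : 0 < u := hu
    have huc : (u : ℂ) ≠ 0 := by exact_mod_cast hu0.ne'
    simp only [widderKernel, widderWeight, hG]
    rw [show -ν + 1 / 2 = (-ν - 1 / 2) + 1 by ring, Complex.cpow_add _ _ huc, Complex.cpow_one,
      div_eq_mul_one_div, Complex.ofReal_mul]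
    ring
  have hG1 : IntegrableOn (fun u : ℝ => ((1 / (u ^ 2 + 1 ^ 2) : ℝ) : ℂ) * G u) (Ioi 0) :=
    (hg 1 one_pos).congr_fun (hGpt 1) measurableSet_Ioi
  have hGm : AEStronglyMeasurable G (volume.restrict (Ioi 0)) := by
    have h1 : AEStronglyMeasurable (fun u : ℝ => ((u ^ 2 + 1 ^ 2 : ℝ) : ℂ))
      (volume.restrict (Ioi 0)) := by fun_prop
    refine (h1.mul hG1.aestronglyMeasurable).congr (.of_forall fun u => ?_)
    have h2 : ((u ^ 2 + 1 ^ 2 : ℝ) : ℂ) ≠ 0 := by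
      exact_mod_cast (by positivity : u ^ 2 + 1 ^ 2 ≠ 0)
    simp only [Pi.mul_apply]
    rw [Complex.ofReal_div, Complex.ofReal_one, ← mul_assoc, mul_one_div, div_self h2, one_mul]
  have hGn : IntegrableOn (fun u : ℝ => 1 / (u ^ 2 + 1) * ‖G u‖) (Ioi 0) := by
    refine (Integrable.norm hG1).congr (.of_forall fun u => ?_)
    simp only
    rw [norm_mul, Complex.norm_real, Real.norm_of_nonneg (by positivity), one_pow]
  obtain ⟨D, hD⟩ := exists_norm_mul_regMacdonald_le hν hx
  set κ : ℂ := (2 : ℂ) ^ (-ν) / 2 * (x : ℂ) ^ (ν + 1 / 2) with hκ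
  set h : ℝ → ℂ := fun y => (y : ℂ) ^ (ν + 1 / 2) * rootBessel ν (x * y) with hh
  have hhm : Measurable h := by
    have h2 : Measurable fun t : ℝ => (t : ℂ) ^ (ν + 1 / 2) :=
      Complex.measurable_ofReal.pow_const _
    exact h2.mul ((measurable_rootBessel hν).comp (by fun_prop))
  set m : ℕ → ℝ → ℝ := fun n y =>
    Real.exp (-(1 / ((n : ℝ) + 1)) * y ^ 2) - Real.exp (-((n : ℝ) + 1) * y ^ 2) with hm
  have hn1 : ∀ n : ℕ, (1 : ℝ) ≤ n + 1 := fun n => by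
    have : (0 : ℝ) ≤ n := Nat.cast_nonneg n
    linarith
  have hnε : ∀ n : ℕ, 0 < 1 / ((n : ℝ) + 1) := fun n => Nat.one_div_pos_of_nat
  have hm0 : ∀ n y, 0 ≤ m n y := by
    intro n y
    have h1 := hn1 n
    have h2 : 1 / ((n : ℝ) + 1) ≤ n + 1 :=
      ((div_le_one (by linarith)).2 h1).trans h1
    simp only [hm, sub_nonneg]
    apply Real.exp_le_exp.2
    nlinarith [sq_nonneg y]
  have hm1 : ∀ n y, m n y ≤ 1 := by
    intro n y
    have h1 : Real.exp (-(1 / ((n : ℝ) + 1)) * y ^ 2) ≤ 1 :=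
      Real.exp_le_one_iff.2 (by have := hnε n; nlinarith [sq_nonneg y])
    have := Real.exp_pos (-((n : ℝ) + 1) * y ^ 2)
    simp only [hm]
    linarith
  have hm2 : ∀ n y, m n y ≤ Real.exp (-(1 / ((n : ℝ) + 1)) * y ^ 2) * (((n : ℝ) + 1) * y ^ 2) := by
    intro n y
    set a := 1 / ((n : ℝ) + 1)
    have ha : 0 < a := hnε n
    have h1 : Real.exp (-((n : ℝ) + 1) * y ^ 2) =
        Real.exp (-a * y ^ 2) * Real.exp (-((n + 1 - a) * y ^ 2)) := by
      rw [← Real.exp_add]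
      ring_nf
    have h2 := Real.add_one_le_exp (-(((n : ℝ) + 1 - a) * y ^ 2))
    have h3 := Real.exp_pos (-a * y ^ 2)
    have h4 : 1 - Real.exp (-(((n : ℝ) + 1 - a) * y ^ 2)) ≤ (n + 1) * y ^ 2 := by
      nlinarith [mul_nonneg ha.le (sq_nonneg y)]
    simp only [hm]
    rw [h1]
    nlinarith [mul_le_mul_of_nonneg_left h4 h3.le]
  -- the product `m(y) / (u² + y²)` is bounded near `y = 0` uniformly in `u`
  have hmk : ∀ n y u, 0 < y → m n y * (1 / (u ^ 2 + y ^ 2)) ≤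
      ((n : ℝ) + 2) * Real.exp (-(1 / ((n : ℝ) + 1)) * y ^ 2) * (1 / (u ^ 2 + 1)) := by
    intro n y u hy
    have h1 := hm2 n y
    have h0 : m n y ≤ Real.exp (-(1 / ((n : ℝ) + 1)) * y ^ 2) := by
      have := Real.exp_pos (-((n : ℝ) + 1) * y ^ 2)
      simp only [hm]
      linarith
    have hn := hn1 n
    set e := Real.exp (-(1 / ((n : ℝ) + 1)) * y ^ 2)
    have he : 0 < e := Real.exp_pos _
    rw [mul_one_div, mul_one_div, div_le_div_iff₀ (by positivity) (by positivity)]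
    have h2 : e * u ^ 2 ≥ 0 := by positivity
    have h3 : e * y ^ 2 ≥ 0 := by positivity
    nlinarith [mul_le_mul_of_nonneg_right h0 (sq_nonneg u)]
  have hmm : ∀ n, Measurable (m n) := fun n => by fun_prop
  have hprod : ∀ n : ℕ, Integrable (fun p : ℝ × ℝ =>
      (h p.1 * (m n p.1 : ℂ) * ((1 / (p.2 ^ 2 + p.1 ^ 2) : ℝ) : ℂ)) * G p.2)
      ((volume.restrict (Ioi 0)).prod (volume.restrict (Ioi 0))) := by
    intro n
    have h1 := Integrable.mul_prod
      ((integrableOn_cpow_mul_rootBessel hν hx (hnε n)).norm.const_mul ((n : ℝ) + 2)) hGn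
    refine Integrable.mono' h1 ?_ ?_
    · refine AEStronglyMeasurable.mul (Measurable.aestronglyMeasurable ?_) hGm.comp_snd
      exact ((hhm.comp measurable_fst).mul
        (Complex.measurable_ofReal.comp ((hmm n).comp measurable_fst))).mul (by fun_prop)
    · rw [Measure.prod_restrict]
      filter_upwards [ae_restrict_mem (measurableSet_Ioi.prod measurableSet_Ioi)] with p hp
      obtain ⟨hy, hu⟩ : 0 < p.1 ∧ 0 < p.2 := hp
      have he : ‖h p.1 * (Real.exp (-(1 / ((n : ℝ) + 1)) * p.1 ^ 2) : ℂ)‖ =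
          ‖h p.1‖ * Real.exp (-(1 / ((n : ℝ) + 1)) * p.1 ^ 2) := by
        rw [norm_mul, Complex.norm_real, Real.norm_eq_abs, Real.abs_exp]
      change _ ≤ ((n : ℝ) + 2) * ‖h p.1 * (Real.exp (-(1 / ((n : ℝ) + 1)) * p.1 ^ 2) : ℂ)‖ * _
      rw [he, norm_mul, norm_mul, norm_mul, Complex.norm_real, Complex.norm_real,
        Real.norm_of_nonneg (hm0 n p.1), Real.norm_of_nonneg (by positivity), mul_assoc ‖h p.1‖]
      calc _ ≤ ‖h p.1‖ * (((n : ℝ) + 2) * Real.exp (-(1 / ((n : ℝ) + 1)) * p.1 ^ 2) *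
            (1 / (p.2 ^ 2 + 1))) * ‖G p.2‖ :=
            mul_le_mul_of_nonneg_right (mul_le_mul_of_nonneg_left (hmk n p.1 p.2 hy)
              (norm_nonneg _)) (norm_nonneg _)
        _ = _ := by ring
  have hu_inner : ∀ n : ℕ, ∀ u ∈ Ioi (0 : ℝ), ∫ y in Ioi (0 : ℝ),
      (h y * (m n y : ℂ) * ((1 / (u ^ 2 + y ^ 2) : ℝ) : ℂ)) * G u =
      κ * (regMacdonald ν x u (1 / ((n : ℝ) + 1)) - regMacdonald ν x u ((n : ℝ) + 1)) * G u := by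
    intro n u hu
    have hu0 : 0 < u := hu
    have hT : (0 : ℝ) < n + 1 := by linarith [hn1 n]
    have hi : ∀ ε : ℝ, 0 < ε → IntegrableOn (fun y : ℝ => h y * (Real.exp (-ε * y ^ 2) : ℂ) *
        ((1 / (u ^ 2 + y ^ 2) : ℝ) : ℂ)) (Ioi 0) := by
      intro ε hε
      refine (integrableOn_cpow_mul_rootBessel hν hx hε).mul_bdd (c := 1 / u ^ 2)
        (Measurable.aestronglyMeasurable (by fun_prop)) (.of_forall fun y => ?_)
      rw [Complex.norm_real, Real.norm_of_nonneg (by positivity)]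
      gcongr
      exact le_add_of_nonneg_right (sq_nonneg _)
    rw [integral_mul_const, mul_sub, ← integral_rootBessel_mul_exp_div hν hx hu0 (hnε n),
      ← integral_rootBessel_mul_exp_div hν hx hu0 hT, ← integral_sub (hi _ (hnε n)) (hi _ hT)]
    congr 1
    refine integral_congr_ae (.of_forall fun y => ?_)
    simp only [hm, hh]
    push_cast
    ring
  have hreg : ∀ n : ℕ, ∫ y in Ioi (0 : ℝ),
      h y * widderTransform (widderWeight ν g) y * (m n y : ℂ) =
      ∫ u in Ioi (0 : ℝ), κ * (regMacdonald ν x u (1 / ((n : ℝ) + 1)) -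
        regMacdonald ν x u ((n : ℝ) + 1)) * G u := by
    intro n
    rw [← setIntegral_congr_fun measurableSet_Ioi (hu_inner n),
      ← integral_integral_swap (f := fun y u : ℝ => (h y * (m n y : ℂ) *
        ((1 / (u ^ 2 + y ^ 2) : ℝ) : ℂ)) * G u) (hprod n)]
    refine setIntegral_congr_fun measurableSet_Ioi fun y hy => ?_
    rw [widderTransform, setIntegral_congr_fun measurableSet_Ioi (hGpt y), mul_right_comm,
      ← integral_const_mul]
    refine integral_congr_ae (.of_forall fun u => ?_)
    simp only
    ring
  have hεlim : Tendsto (fun n : ℕ => 1 / ((n : ℝ) + 1)) atTop (𝓝[>] 0) :=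
    tendsto_nhdsWithin_iff.2 ⟨tendsto_one_div_add_atTop_nhds_zero_nat, .of_forall hnε⟩
  have hTlim : Tendsto (fun n : ℕ => (n : ℝ) + 1) atTop atTop :=
    tendsto_atTop_add_const_right _ _ tendsto_natCast_atTop_atTop
  have hlimL : Tendsto (fun n : ℕ => ∫ y in Ioi (0 : ℝ),
      h y * widderTransform (widderWeight ν g) y * (m n y : ℂ)) atTop
      (𝓝 (∫ y in Ioi (0 : ℝ), h y * widderTransform (widderWeight ν g) y)) := by
    refine tendsto_integral_of_dominated_convergence
      (fun y => ‖h y * widderTransform (widderWeight ν g) y‖) (fun n =>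
      hH.aestronglyMeasurable.mul
        (Complex.measurable_ofReal.comp (hmm n)).aestronglyMeasurable) hH.norm (fun n => ?_) ?_
    · refine .of_forall fun y => ?_
      rw [norm_mul]
      refine mul_le_of_le_one_right (norm_nonneg _) ?_
      rw [Complex.norm_real, Real.norm_of_nonneg (hm0 n y)]
      exact hm1 n y
    · filter_upwards [ae_restrict_mem measurableSet_Ioi] with y hy
      have hy0 : 0 < y := hy
      have h1 : Tendsto (fun n : ℕ => Real.exp (-(1 / ((n : ℝ) + 1)) * y ^ 2)) atTop (𝓝 1) := by
        have := ((tendsto_nhdsWithin_iff.1 hεlim).1.neg.mul_const (y ^ 2)).rexp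
        simpa using this
      have h2 : Tendsto (fun n : ℕ => Real.exp (-((n : ℝ) + 1) * y ^ 2)) atTop (𝓝 0) := by
        have := Real.tendsto_exp_neg_atTop_nhds_zero.comp
          (hTlim.atTop_mul_const (by positivity : 0 < y ^ 2))
        refine this.congr fun n => ?_
        simp only [Function.comp, neg_mul]
      have h3 := (Complex.continuous_ofReal.tendsto _).comp (h1.sub h2)
      have h4 := h3.const_mul (h y * widderTransform (widderWeight ν g) y)
      rw [sub_zero, Complex.ofReal_one, mul_one] at h4
      exact h4
  have hlimR : Tendsto (fun n : ℕ => ∫ u in Ioi (0 : ℝ),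
      κ * (regMacdonald ν x u (1 / ((n : ℝ) + 1)) - regMacdonald ν x u ((n : ℝ) + 1)) * G u) atTop
      (𝓝 (∫ u in Ioi (0 : ℝ), kKernel ν u x * g u)) := by
    refine tendsto_integral_of_dominated_convergence
      (fun u => ‖κ‖ * (2 * D) * (1 / (u ^ 2 + 1) * ‖G u‖ + ‖kKernel ν u x * g u‖)) (fun n => ?_)
      ((Integrable.add hGn hK.norm).const_mul _) (fun n => ?_) ?_
    · have h1 := (hprod n).integral_prod_right.aestronglyMeasurable
      refine h1.congr ?_
      filter_upwards [ae_restrict_mem measurableSet_Ioi] with u hu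
      exact hu_inner n u hu
    · filter_upwards [ae_restrict_mem measurableSet_Ioi] with u hu
      have hu0 : 0 < u := hu
      have hT : (0 : ℝ) < n + 1 := by linarith [hn1 n]
      have b1 := hD u _ hu0 (hnε n)
      have b2 := hD u _ hu0 hT
      have e : κ * (regMacdonald ν x u (1 / ((n : ℝ) + 1)) - regMacdonald ν x u ((n : ℝ) + 1)) *
          G u = κ * ((u : ℂ) ^ (-ν + 1 / 2) * regMacdonald ν x u (1 / ((n : ℝ) + 1)) -
            (u : ℂ) ^ (-ν + 1 / 2) * regMacdonald ν x u ((n : ℝ) + 1)) * g u := by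
        simp only [hG]
        ring
      rw [e, norm_mul, norm_mul]
      calc _ ≤ ‖κ‖ * (D * (‖(u : ℂ) ^ (-ν + 1 / 2)‖ * (1 / (u ^ 2 + 1)) + ‖kKernel ν u x‖) +
            D * (‖(u : ℂ) ^ (-ν + 1 / 2)‖ * (1 / (u ^ 2 + 1)) + ‖kKernel ν u x‖)) * ‖g u‖ := by
            gcongr
            exact (norm_sub_le _ _).trans (add_le_add b1 b2)
        _ = _ := by
          rw [norm_mul (kKernel ν u x), show ‖G u‖ = _ from norm_mul _ _]
          ring
    · filter_upwards [ae_restrict_mem measurableSet_Ioi] with u hu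
      have hu0 : 0 < u := hu
      have huc : (u : ℂ) ≠ 0 := by exact_mod_cast hu0.ne'
      have h1 := ((((tendsto_regMacdonald_zero hν hx hu0).comp hεlim).sub
        ((tendsto_regMacdonald_atTop hν hx hu0).comp hTlim)).const_mul κ).mul_const (G u)
      have e : κ * (regMacdonald ν x u 0 - 0) * G u = kKernel ν u x * g u := by
        rw [sub_zero, const_mul_regMacdonald_zero hν hx hu0, kKernel_comm ν x u]
        have h2 : (u : ℂ) ^ (ν - 1 / 2) * (u : ℂ) ^ (-ν + 1 / 2) = 1 := by
          rw [← Complex.cpow_add _ _ huc]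
          simp
        simp only [hG]
        linear_combination (kKernel ν u x * g u) * h2
      rw [e] at h1
      exact h1
  have heq := tendsto_nhds_unique hlimL (hlimR.congr fun n => (hreg n).symm)
  rw [heq, kTransform]

/-! ### The identities -/

theorem theorem2 (ν : ℂ) (hν : -1 < ν.re) (f g : ℝ → ℂ)
    -- absolute convergence of the double integral of `f(x) √(xu) K_ν(xu) g(u)`
    (hK : IntegrableOn (fun p : ℝ × ℝ => f p.1 * (kKernel ν p.2 p.1 * g p.2))
      (Ioi (0 : ℝ) ×ˢ Ioi (0 : ℝ))) :
    ((∀ y : ℝ, 0 < y → IntegrableOn (fun x : ℝ => hankelKernel ν x y * f x) (Ioi 0)) →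
      (∀ y : ℝ, 0 < y →
        IntegrableOn (fun u : ℝ => widderKernel u y * widderWeight ν g u) (Ioi 0)) →
      -- the left side converges absolutely as a double integral, in the variables `(y, u)` or in
      -- the variables `(y, x)`
      (IntegrableOn (fun p : ℝ × ℝ => (p.1 : ℂ) ^ (ν + 1 / 2) * hankelTransform ν f p.1 *
            (widderKernel p.2 p.1 * widderWeight ν g p.2))
          (Ioi (0 : ℝ) ×ˢ Ioi (0 : ℝ)) ∨
        IntegrableOn (fun p : ℝ × ℝ => (p.1 : ℂ) ^ (ν + 1 / 2) *
            (hankelKernel ν p.2 p.1 * f p.2) * widderTransform (widderWeight ν g) p.1)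
          (Ioi (0 : ℝ) ×ˢ Ioi (0 : ℝ))) →
      (∫ y in Ioi (0 : ℝ), (y : ℂ) ^ (ν + 1 / 2) * hankelTransform ν f y *
            widderTransform (widderWeight ν g) y =
          ∫ x in Ioi (0 : ℝ), f x * kTransform ν g x) ∧
      (∫ y in Ioi (0 : ℝ), (y : ℂ) ^ (ν + 1 / 2) * hankelTransform ν f y *
            widderTransform (widderWeight ν g) y =
          ∫ u in Ioi (0 : ℝ), g u * kTransform ν f u)) ∧
    (∫ x in Ioi (0 : ℝ), f x * kTransform ν g x =
      ∫ u in Ioi (0 : ℝ), g u * kTransform ν f u) := by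
  rw [integrableOn_prod_Ioi_iff] at hK
  have h3 : ∫ x in Ioi (0 : ℝ), f x * kTransform ν g x =
      ∫ u in Ioi (0 : ℝ), g u * kTransform ν f u := by
    simp only [kTransform, ← integral_const_mul]
    rw [integral_integral_swap (f := fun x u => f x * (kKernel ν u x * g u)) hK]
    refine integral_congr_ae (.of_forall fun u => integral_congr_ae (.of_forall fun x => ?_))
    simp only
    rw [kKernel_comm ν u x]
    ring
  refine ⟨fun hf hg hor => ?_, h3⟩
  suffices h : ∫ y in Ioi (0 : ℝ), (y : ℂ) ^ (ν + 1 / 2) * hankelTransform ν f y *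
      widderTransform (widderWeight ν g) y = ∫ x in Ioi (0 : ℝ), f x * kTransform ν g x from
    ⟨h, h.trans h3⟩
  rcases hor with hH | hH
  · rw [integrableOn_prod_Ioi_iff] at hH
    rw [h3]
    simp only [widderTransform, ← integral_const_mul]
    rw [integral_integral_swap (f := fun y u : ℝ => (y : ℂ) ^ (ν + 1 / 2) *
      hankelTransform ν f y * (widderKernel u y * widderWeight ν g u)) hH]
    refine integral_congr_ae ?_
    filter_upwards [hH.prod_left_ae, hK.prod_left_ae, ae_restrict_mem measurableSet_Ioi]
      with u hHu hKu hu
    have hu0 : 0 < u := hu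
    have huc : (u : ℂ) ≠ 0 := by exact_mod_cast hu0.ne'
    by_cases hgu : g u = 0
    · simp [widderWeight, hgu]
    have hw : (u : ℂ) * widderWeight ν g u ≠ 0 := by
      simp [widderWeight, Complex.cpow_eq_zero_iff, huc, hgu]
    have hpt : ∀ y : ℝ, (y : ℂ) ^ (ν + 1 / 2) * hankelTransform ν f y *
        (widderKernel u y * widderWeight ν g u) = ((y : ℂ) ^ (ν + 1 / 2) *
          hankelTransform ν f y * ((1 / (u ^ 2 + y ^ 2) : ℝ) : ℂ)) * (u * widderWeight ν g u) := by
      intro y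
      rw [widderKernel, div_eq_mul_one_div u, Complex.ofReal_mul]
      ring
    simp only [hpt] at hHu ⊢
    have hKu' : IntegrableOn (fun x => kKernel ν x u * f x) (Ioi 0) := by
      refine (hKu.div_const (g u)).congr (.of_forall fun x => ?_)
      simp only
      rw [kKernel_comm ν u x]
      field_simp
    have hHu' := (hHu.div_const (u * widderWeight ν g u)).congr
      (.of_forall fun y => mul_div_cancel_right₀ _ hw)
    rw [integral_mul_const, integral_hankelTransform_div hν hf hu0 hHu' hKu']
    have h2 : (u : ℂ) ^ (ν - 1 / 2) * (u : ℂ) ^ (-ν - 1 / 2) * u = 1 := by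
      rw [← Complex.cpow_add _ _ huc, show ν - 1 / 2 + (-ν - 1 / 2) = -1 by ring,
        Complex.cpow_neg_one, inv_mul_cancel₀ huc]
    rw [widderWeight]
    linear_combination (g u * kTransform ν f u) * h2
  · rw [integrableOn_prod_Ioi_iff] at hH
    have h1 : ∀ y : ℝ, (y : ℂ) ^ (ν + 1 / 2) * hankelTransform ν f y *
        widderTransform (widderWeight ν g) y = ∫ x in Ioi (0 : ℝ), (y : ℂ) ^ (ν + 1 / 2) *
          (hankelKernel ν x y * f x) * widderTransform (widderWeight ν g) y := by
      intro y
      rw [integral_mul_const, integral_const_mul, hankelTransform]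
    simp only [h1]
    rw [integral_integral_swap (f := fun y x : ℝ => (y : ℂ) ^ (ν + 1 / 2) *
          (hankelKernel ν x y * f x) * widderTransform (widderWeight ν g) y) hH]
    refine integral_congr_ae ?_
    filter_upwards [hH.prod_left_ae, hK.prod_right_ae, ae_restrict_mem measurableSet_Ioi]
      with x hHx hKx hx
    have hx0 : 0 < x := hx
    by_cases hfx : f x = 0
    · simp [hfx]
    have hpt : ∀ y ∈ Ioi (0 : ℝ), (y : ℂ) ^ (ν + 1 / 2) * (hankelKernel ν x y * f x) *
        widderTransform (widderWeight ν g) y = f x * ((y : ℂ) ^ (ν + 1 / 2) *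
          rootBessel ν (x * y) * widderTransform (widderWeight ν g) y) := by
      intro y hy
      rw [hankelKernel_eq ν hx0 hy]
      ring
    have hHx' : IntegrableOn (fun y : ℝ => f x * ((y : ℂ) ^ (ν + 1 / 2) * rootBessel ν (x * y) *
        widderTransform (widderWeight ν g) y)) (Ioi 0) :=
      IntegrableOn.congr_fun hHx hpt measurableSet_Ioi
    have hHx'' := (hHx'.div_const (f x)).congr (.of_forall fun y => mul_div_cancel_left₀ _ hfx)
    have hKx' := (hKx.div_const (f x)).congr (.of_forall fun u => mul_div_cancel_left₀ _ hfx)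
    rw [setIntegral_congr_fun measurableSet_Ioi hpt, integral_const_mul,
      integral_rootBessel_mul_widderTransform hν hg hx0 hHx'' hKx']
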